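/- **Theorem 1.** $\#\mathrm{SAT} \le^p_{\mathrm{par}} \#\mathrm{TRP}$. That is, there is a polynomial-time computable function $\rho:\{0,1\}^*\to\{0,1\}^*$ such that $\#\mathrm{SAT}(x)=\#\mathrm{TRP}(\rho(x))$ for every $x\in\{0,1\}^*$. Here $\#\mathrm{SAT}(x)$ is the number of satisfying truth assignments to the variables occurring in the boolean formula (built from variables with $\neg,\wedge,\vee$) that is encoded by $x$, and $\#\mathrm{TRP}(x)$ is the number of solutions of the finite Tantrix rotation puzzle encoded by $x$; both are $0$ if $x$ encodes no such object. A *Tantrix tile* is a hexagonal tile whose six edges are joined in pairs by three lines of three different colors chosen among red, yellow, blue and green, in one of the four forms Sint, Brid, Chin, Rond (that is, any form except three straight lines); up to rotation there are 56 tiles. Two positions $(u,w),(v,x)\in\mathbb Z^2$ are adjacent iff $u=v$ and $|w-x|=1$, or $|u-v|=1$ and $w=x$, or $u-v=w-x=\pm1$; so each position has six neighbors, and $\mathbb Z^2$ becomes the hexagonal grid. A *finite rotation puzzle* is a partial function $\mathcal A$ with finite domain from $\mathbb Z^2$ to the set of tiles, where $\mathcal A(v)$ is the tile placed at $v$ (its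 orientation is not prescribed). A *solution* of $\mathcal A$ chooses one of the six orientations for each placed tile such that at each joint edge of two tiles at adjacent positions the two colors are equal. -/

import Mathlib

/-! ### Polynomial-time parsimonious reductions between counting problems -/

/-- A function on bit strings is polynomial-time computable if some Turing machine computes it
within a number of steps polynomial in the length of the input. -/
def PolyTimeComputable (f : List Bool → List Bool) : Prop :=
  Nonempty (Turing.TM2ComputableInPolyTime (id : List Bool → List Bool)
    (id : List Bool → List Bool) f)

/-- The counting problem `f` (polynomial-time) parsimoniously reduces to the counting
problem `g`. -/
def ParsimoniouslyReduces (f g : List Bool → ℕ) : Prop :=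
  ∃ ρ : List Bool → List Bool, PolyTimeComputable ρ ∧ ∀ x, f x = g (ρ x)

/-! ### Boolean formulas and the counting problem `#SAT` -/

/-- Boolean formulas. The variables are `x_w`, where the name `w` is any bit string
(for instance the binary numeral of an index). -/
inductive BoolFormula : Type
  | var (w : List Bool)
  | neg (φ : BoolFormula)
  | conj (φ ψ : BoolFormula)
  | disj (φ ψ : BoolFormula)

namespace BoolFormula

/-- The names of the variables that occur in a formula. -/
def vars : BoolFormula → Finset (List Bool)
  | var w => {w}
  | neg φ => φ.vars
  | conj φ ψ => φ.vars ∪ ψ.vars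
  | disj φ ψ => φ.vars ∪ ψ.vars

/-- The truth value of a formula. -/
def eval (a : List Bool → Bool) : BoolFormula → Bool
  | var w => a w
  | neg φ => !(φ.eval a)
  | conj φ ψ => φ.eval a && ψ.eval a
  | disj φ ψ => φ.eval a || ψ.eval a

/-- A truth assignment to the variables of `φ` satisfies `φ`. (The value `false` for other
variables is never looked at.) -/
def Satisfies (φ : BoolFormula) (a : {w // w ∈ φ.vars} → Bool) : Prop :=
  φ.eval (fun w => if h : w ∈ φ.vars then a ⟨w, h⟩ else false) = true

/-- The number of satisfying assignments to the variables occurring in `φ`. -/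
noncomputable def numSat (φ : BoolFormula) : ℕ :=
  Nat.card {a : {w // w ∈ φ.vars} → Bool // φ.Satisfies a}

/-- The self-delimiting code of a variable name: each bit `b` becomes `1b`, and `0` ends it. -/
def encodeName : List Bool → List Bool
  | [] => [false]
  | b :: w => true :: b :: encodeName w

/-- Formulas are written in prefix (Polish) notation, with the symbols `00` (variable, followed
by its name), `01` (negation), `10` (conjunction) and `11` (disjunction). -/
def encode : BoolFormula → List Bool
  | var w => false :: false :: encodeName w
  | neg φ => false :: true :: φ.encode
  | conj φ ψ => true :: false :: (φ.encode ++ ψ.encode)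
  | disj φ ψ => true :: true :: (φ.encode ++ ψ.encode)

theorem encodeName_append_inj {v w s t : List Bool}
    (h : encodeName v ++ s = encodeName w ++ t) : v = w ∧ s = t := by
  induction v generalizing w with
  | nil => cases w <;> simp_all [encodeName]
  | cons b v ih =>
    cases w with
    | nil => simp [encodeName] at h
    | cons c w =>
      simp only [encodeName, List.cons_append, List.cons.injEq, true_and] at h
      obtain ⟨h1, h2⟩ := ih h.2
      exact ⟨by rw [h.1, h1], h2⟩

theorem encode_append_inj {φ ψ : BoolFormula} {s t : List Bool}
    (h : φ.encode ++ s = ψ.encode ++ t) : φ = ψ ∧ s = t := by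
  induction φ generalizing ψ s t with
  | var w =>
    cases ψ <;> simp [encode] at h
    obtain ⟨h1, h2⟩ := encodeName_append_inj h
    exact ⟨by rw [h1], h2⟩
  | neg φ ih =>
    cases ψ <;> simp [encode] at h
    obtain ⟨h1, h2⟩ := ih h
    exact ⟨by rw [h1], h2⟩
  | conj φ φ' ih ih' =>
    cases ψ <;> simp [encode] at h
    obtain ⟨h1, h2⟩ := ih h
    obtain ⟨h3, h4⟩ := ih' h2
    exact ⟨by rw [h1, h3], h4⟩
  | disj φ φ' ih ih' =>
    cases ψ <;> simp [encode] at h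
    obtain ⟨h1, h2⟩ := ih h
    obtain ⟨h3, h4⟩ := ih' h2
    exact ⟨by rw [h1, h3], h4⟩

/-- A string is the code of at most one formula. -/
theorem encode_injective : Function.Injective encode := fun φ ψ h =>
  (encode_append_inj (s := []) (t := []) (by rw [h])).1

end BoolFormula

/-- The counting problem `#SAT`: the number of satisfying assignments of the formula that `x`
encodes (and `0` if `x` does not encode a formula). -/
noncomputable def sharpSAT (x : List Bool) : ℕ :=
  match Function.partialInv BoolFormula.encode x with
  | some φ => φ.numSat
  | none => 0

/-! ### Tantrix tiles -/

/-- The four colors. -/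
inductive TantrixColor : Type
  | red | yellow | blue | green
  deriving DecidableEq

instance : Fintype TantrixColor where
  elems := {.red, .yellow, .blue, .green}
  complete c := by cases c <;> decide

/-- The four kinds of tiles. -/
inductive TileKind : Type
  | sint | brid | chin | rond
  deriving DecidableEq

instance : Fintype TileKind where
  elems := {.sint, .brid, .chin, .rond}
  complete k := by cases k <;> decide

/-- A number for each color. -/
def TantrixColor.toFin : TantrixColor → Fin 4
  | red => 0
  | yellow => 1
  | blue => 2
  | green => 3

/-- The clockwise sequence of the colors of the six edges of a tile in its reference orientation,
where `p`, `q`, `s` are the colors of its three lines. Sint: one line joins two neighboring edges,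
and the two others, each joining edges at distance two, cross. Brid: a straight line crossed by
two lines joining edges at distance two. Chin: a straight line between two lines joining
neighboring edges. Rond: three lines joining neighboring edges. -/
def TileKind.edges (k : TileKind) (p q s : TantrixColor) : Fin 6 → TantrixColor :=
  match k with
  | sint => ![p, p, q, s, q, s]
  | brid => ![p, q, s, p, s, q]
  | chin => ![p, q, q, p, s, s]
  | rond => ![p, p, q, q, s, s]

/-- For a rotationally symmetric kind of line drawing, different distributions of the colors to
the lines give the same tile up to rotation. This picks one of them: for a Brid and a Chin the two
lines that are exchanged by a half turn are listed in the order of their colors, and for a Rond the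
list of the colors starts with the first of the three. -/
def TileKind.IsCanonical (k : TileKind) (p q s : TantrixColor) : Prop :=
  match k with
  | sint => True
  | brid => q.toFin < s.toFin
  | chin => q.toFin < s.toFin
  | rond => p.toFin < q.toFin ∧ p.toFin < s.toFin

instance (k : TileKind) (p q s : TantrixColor) : Decidable (k.IsCanonical p q s) := by
  cases k <;> unfold TileKind.IsCanonical <;> infer_instance

/-- The set of the 56 Tantrix tiles: a kind and three different colors for the three lines,
where tiles that arise from each other by a rotation are not distinguished. -/
@[ext] structure TantrixTile where
  /-- the kind of the tile -/
  kind : TileKind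
  /-- the color of the first line -/
  p : TantrixColor
  /-- the color of the second line -/
  q : TantrixColor
  /-- the color of the third line -/
  s : TantrixColor
  distinct : p ≠ q ∧ p ≠ s ∧ q ≠ s
  canonical : kind.IsCanonical p q s

namespace TantrixTile

/-- The color that the edge `i` (numbered clockwise, as the six directions below) of the tile `t`
shows after `t` was rotated by `r` times 60 degrees clockwise from its reference orientation.
The subtraction is modulo `6`. -/
def color (t : TantrixTile) (r i : Fin 6) : TantrixColor :=
  t.kind.edges t.p t.q t.s (i - r)

/-- The six orientations of a tile look different, so that an orientation is given by a
rotation. -/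
theorem color_injective (t : TantrixTile) : Function.Injective t.color := by
  obtain ⟨k, p, q, s, hd, _⟩ := t
  have key : ∀ (k : TileKind) (p q s : TantrixColor), p ≠ q ∧ p ≠ s ∧ q ≠ s →
      ∀ r r' : Fin 6, (∀ i, k.edges p q s (i - r) = k.edges p q s (i - r')) → r = r' := by
    decide
  intro r r' h
  exact key k p q s hd r r' (fun i => congrFun h i)

end TantrixTile

/-! ### The Tantrix rotation puzzle and the counting problem `#TRP` -/

/-- The steps from a position of the hexagonal coordinate system to its six neighbors, in
clockwise order. The direction opposite to `i` is `i + 3` modulo `6`. -/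
def hexDir : Fin 6 → ℤ × ℤ :=
  ![(0, 1), (1, 1), (1, 0), (0, -1), (-1, -1), (-1, 0)]

/-- An instance of the Tantrix rotation puzzle problem: a partial function from `ℤ²` to the set of
tiles with finite domain of definition. -/
structure TRPInstance where
  /-- the tile at a position, if there is one -/
  tile : ℤ × ℤ → Option TantrixTile
  finite_shape : {v | (tile v).isSome}.Finite

namespace TRPInstance

/-- The set of the positions at which tiles are placed. -/
def shape (A : TRPInstance) : Set (ℤ × ℤ) := {v | (A.tile v).isSome}

/-- The tile at a position of the shape. -/
def tileOn (A : TRPInstance) (v : A.shape) : TantrixTile := (A.tile v).get v.2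

/-- A rotation of each of the tiles is a solution if the colors match at each joint edge of two
adjacent tiles. -/
def IsSolution (A : TRPInstance) (r : A.shape → Fin 6) : Prop :=
  ∀ (a b : A.shape) (i : Fin 6), (b : ℤ × ℤ) = (a : ℤ × ℤ) + hexDir i →
    (A.tileOn a).color (r a) i = (A.tileOn b).color (r b) (i + 3)

/-- The number of solutions of a puzzle. -/
noncomputable def numSolutions (A : TRPInstance) : ℕ :=
  Nat.card {r : A.shape → Fin 6 // A.IsSolution r}

/-- The instance given by a list of pairs of a position and a tile; here no position is to occur
twice. -/
def ofList (l : List ((ℤ × ℤ) × TantrixTile)) : TRPInstance where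
  tile v := l.lookup v
  finite_shape := by
    refine (l.map Prod.fst).finite_toSet.subset fun v hv => ?_
    by_contra hne
    have hnone : l.lookup v = none := by
      rw [List.lookup_eq_none_iff]
      rintro ⟨u, t⟩ hu
      rw [bne_iff_ne]
      rintro rfl
      exact hne (List.mem_map.2 ⟨(v, t), hu, rfl⟩)
    rw [Set.mem_ofPred_eq, hnone] at hv
    exact Bool.false_ne_true hv

end TRPInstance

/-- `1 … 10`, with `n` ones. -/
def encodeUnary (n : ℕ) : List Bool := List.replicate n true ++ [false]

/-- The code of an integer coordinate: a sign bit, followed by a number in unary. (Reductions to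
puzzles given in this format can be turned, in polynomial time, into reductions to puzzles whose
coordinates are written in binary.) -/
def encodeInt : ℤ → List Bool
  | Int.ofNat n => false :: encodeUnary n
  | Int.negSucc n => true :: encodeUnary n

/-- Two bits for each kind. -/
def TileKind.encode : TileKind → List Bool
  | sint => [false, false]
  | brid => [false, true]
  | chin => [true, false]
  | rond => [true, true]

/-- Two bits for each color. -/
def TantrixColor.encode : TantrixColor → List Bool
  | red => [false, false]
  | yellow => [false, true]
  | blue => [true, false]
  | green => [true, true]

/-- Eight bits for each tile. -/
def TantrixTile.encode (t : TantrixTile) : List Bool :=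
  t.kind.encode ++ (t.p.encode ++ (t.q.encode ++ t.s.encode))

/-- The code of a position and the tile placed there. -/
def encodeEntry (e : (ℤ × ℤ) × TantrixTile) : List Bool :=
  encodeInt e.1.1 ++ (encodeInt e.1.2 ++ e.2.encode)

/-- The code of a list of placed tiles. -/
def encodePuzzle : List ((ℤ × ℤ) × TantrixTile) → List Bool
  | [] => []
  | e :: l => encodeEntry e ++ encodePuzzle l

theorem encodeUnary_append_inj {m n : ℕ} {s t : List Bool}
    (h : encodeUnary m ++ s = encodeUnary n ++ t) : m = n ∧ s = t := by
  induction m generalizing n with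
  | zero => cases n <;> simp_all [encodeUnary, List.replicate_succ]
  | succ m ih =>
    cases n with
    | zero => simp [encodeUnary, List.replicate_succ] at h
    | succ n =>
      have h' : encodeUnary m ++ s = encodeUnary n ++ t := by
        simpa [encodeUnary, List.replicate_succ] using h
      obtain ⟨h1, h2⟩ := ih h'
      exact ⟨by rw [h1], h2⟩

theorem encodeInt_append_inj {m n : ℤ} {s t : List Bool}
    (h : encodeInt m ++ s = encodeInt n ++ t) : m = n ∧ s = t := by
  cases m <;> cases n <;> simp [encodeInt] at h <;>
    obtain ⟨h1, h2⟩ := encodeUnary_append_inj h <;> exact ⟨by rw [h1], h2⟩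

theorem TileKind.encode_append_inj {k l : TileKind} {s t : List Bool}
    (h : k.encode ++ s = l.encode ++ t) : k = l ∧ s = t := by
  cases k <;> cases l <;> simp_all [TileKind.encode]

theorem TantrixColor.encode_append_inj {k l : TantrixColor} {s t : List Bool}
    (h : k.encode ++ s = l.encode ++ t) : k = l ∧ s = t := by
  cases k <;> cases l <;> simp_all [TantrixColor.encode]

theorem encodeEntry_append_inj {d e : (ℤ × ℤ) × TantrixTile} {s t : List Bool}
    (h : encodeEntry d ++ s = encodeEntry e ++ t) : d = e ∧ s = t := by
  obtain ⟨⟨x, y⟩, k⟩ := d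
  obtain ⟨⟨x', y'⟩, k'⟩ := e
  simp only [encodeEntry, TantrixTile.encode, List.append_assoc] at h
  obtain ⟨hx, h⟩ := encodeInt_append_inj h
  obtain ⟨hy, h⟩ := encodeInt_append_inj h
  obtain ⟨hk, h⟩ := TileKind.encode_append_inj h
  obtain ⟨hp, h⟩ := TantrixColor.encode_append_inj h
  obtain ⟨hq, h⟩ := TantrixColor.encode_append_inj h
  obtain ⟨hs, h⟩ := TantrixColor.encode_append_inj h
  exact ⟨by rw [hx, hy, TantrixTile.ext hk hp hq hs], h⟩

/-- A string is the code of at most one list of placed tiles. -/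
theorem encodePuzzle_injective : Function.Injective encodePuzzle := by
  have hne : ∀ (e : (ℤ × ℤ) × TantrixTile) (l : List Bool), encodeEntry e ++ l ≠ [] := by
    rintro ⟨⟨x, y⟩, k⟩ l
    cases x <;> simp [encodeEntry, encodeInt]
  intro l
  induction l with
  | nil =>
    intro l' h
    cases l' with
    | nil => rfl
    | cons e l' => exact absurd h.symm (hne _ _)
  | cons d l ih =>
    intro l' h
    cases l' with
    | nil => exact absurd h (hne _ _)
    | cons e l' =>
      obtain ⟨h1, h2⟩ := encodeEntry_append_inj h
      rw [h1, ih h2]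

/-- The counting problem `#TRP`. A string encodes an instance if it lists its tiles, in any order,
with their positions, each position once; then the value is the number of solutions. For all other
strings the value is `0`. -/
noncomputable def sharpTRP (x : List Bool) : ℕ :=
  match Function.partialInv encodePuzzle x with
  | some l => if (l.map Prod.fst).Nodup then (TRPInstance.ofList l).numSolutions else 0
  | none => 0

/-! ### A structured programming language on stacks of bits -/

/-! The formula is turned into a triangular grid with one row and one column for each symbol (token)
of its prefix notation. The column of a token carries a bit, meant to be the truth value of the
subformula that starts there. The row of a token ties this bit to the bits of later columns. Where a
row meets a column there is a cell of six tiles: `cross` lets the row bit pass, `eq` and `neq` tie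
it to the column bit or its negation, `or` makes the west bit the disjunction of the column bit and
the east bit. One further cell `one` sets the first column, which stands for the whole formula, to
`true`.

The count is preserved at each stage. By the finite checks `CellKind.consistent_iff` and
`CellKind.rotation_injective`, the consistent orientations of a cell correspond bijectively to the
bit triples that its relation allows. By `adjacent_cases`, different cells touch only at ports,
whose colors determine the transmitted bit. So solutions of the puzzle are valid labelings of the
cells (`Diagram.Realizes.numSolutions_eq`). The column bits determine all row bits, so these
labelings are counted by the column sequences that satisfy every row (`Token.card_valid`). By
induction on formulas, carried out for lists of formulas because prefix notation concatenates
operands, these sequences are the lists of values of all subformulas under some assignment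
(`BoolFormula.characterized_cons`). The row of a variable enforces equality with all its later
occurrences. A row with an `or` cell between two `neq` cells yields `¬x ∧ y` rather than `x ∧ y`;
therefore `twist` negates the first operand of each conjunction beforehand. Since the first bit is
`true`, exactly the satisfying assignments remain (`BoolFormula.card_good`).

For the running time, structured programs on nine stacks are compiled to Turing machines with the
same number of steps (`Prog.Exec.run`). The program `Prog.reduction` checks the syntax with a
counter of expected formulas, inserts the negations on the way, and then reads the token string once
more for each row, writing the tiles with unary coordinates. The bound of `Prog.reach_reduction` is
cubic in the length of the input. -/

/-- The names of the stacks. -/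
inductive StackName : Type
  | a | b | d | e | f | x | y | t | o
  deriving DecidableEq

instance : Fintype StackName where
  elems := {.a, .b, .d, .e, .f, .x, .y, .t, .o}
  complete k := by cases k <;> decide

/-- The contents of the stacks. -/
structure Store where
  a : List Bool
  b : List Bool
  d : List Bool
  e : List Bool
  f : List Bool
  x : List Bool
  y : List Bool
  t : List Bool
  o : List Bool

namespace Store

/-- The contents of a stack. -/
def get (S : Store) : StackName → List Bool
  | .a => S.a
  | .b => S.b
  | .d => S.d
  | .e => S.e
  | .f => S.f
  | .x => S.x
  | .y => S.y
  | .t => S.t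
  | .o => S.o

/-- Replaces the contents of a stack. -/
def set (S : Store) (k : StackName) (l : List Bool) : Store :=
  match k with
  | .a => { S with a := l }
  | .b => { S with b := l }
  | .d => { S with d := l }
  | .e => { S with e := l }
  | .f => { S with f := l }
  | .x => { S with x := l }
  | .y => { S with y := l }
  | .t => { S with t := l }
  | .o => { S with o := l }

theorem get_set (S : Store) (k : StackName) (l : List Bool) :
    (S.set k l).get = Function.update S.get k l := by
  funext k'
  cases k <;> cases k' <;> simp [get, set, Function.update]

end Store

/-- Structured programs. `pop k p q r` removes the top of the stack `k` and continues with `p`, `q`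
or `r` if the stack was empty, or the top was `false` or `true`. `loop k c p q r` does the same
and repeats after `r`, and, if `c` holds, also after `q`. -/
inductive Prog : Type
  | skip
  | push (k : StackName) (v : Bool)
  | seq (p q : Prog)
  | pop (k : StackName) (p q r : Prog)
  | loop (k : StackName) (c : Bool) (p q r : Prog)

namespace Prog

/-- `Exec p S S' n`: the program `p` leads from the store `S` to the store `S'` in `n` steps. -/
inductive Exec : Prog → Store → Store → ℕ → Prop
  | skip (S) : Exec skip S S 1
  | push (k v S) : Exec (push k v) S (S.set k (v :: S.get k)) 1
  | seq {p q S S' S'' m n} : Exec p S S' m → Exec q S' S'' n → Exec (seq p q) S S'' (n + m)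
  | pop_nil {k p q r S S' n} : S.get k = [] → Exec p S S' n → Exec (pop k p q r) S S' (n + 1)
  | pop_false {k p q r S S' n l} : S.get k = false :: l → Exec q (S.set k l) S' n →
      Exec (pop k p q r) S S' (n + 1)
  | pop_true {k p q r S S' n l} : S.get k = true :: l → Exec r (S.set k l) S' n →
      Exec (pop k p q r) S S' (n + 1)
  | loop_nil {k c p q r S S' n} : S.get k = [] → Exec p S S' n →
      Exec (loop k c p q r) S S' (n + 1)
  | loop_exit {k p q r S S' n l} : S.get k = false :: l → Exec q (S.set k l) S' n →
      Exec (loop k false p q r) S S' (n + 1)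
  | loop_false {k p q r S S' S'' m n l} : S.get k = false :: l → Exec q (S.set k l) S' m →
      Exec (loop k true p q r) S' S'' n → Exec (loop k true p q r) S S'' (n + (m + 1))
  | loop_true {k c p q r S S' S'' m n l} : S.get k = true :: l → Exec r (S.set k l) S' m →
      Exec (loop k c p q r) S' S'' n → Exec (loop k c p q r) S S'' (n + (m + 1))

/-! ### Compilation of structured programs to Turing machines. -/

/-- The labels of the Turing machine for a program. -/
def Label : Prog → Type
  | skip => Unit
  | push _ _ => Unit
  | seq p q => p.Label ⊕ q.Label
  | pop _ p q r => Option (p.Label ⊕ (q.Label ⊕ r.Label))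
  | loop _ _ p q r => Option (p.Label ⊕ (q.Label ⊕ r.Label))

noncomputable instance : ∀ p : Prog, Fintype p.Label
  | skip => inferInstanceAs (Fintype Unit)
  | push _ _ => inferInstanceAs (Fintype Unit)
  | seq p q =>
    let _ := instFintypeLabel p
    let _ := instFintypeLabel q
    inferInstanceAs (Fintype (p.Label ⊕ q.Label))
  | pop _ p q r =>
    let _ := instFintypeLabel p
    let _ := instFintypeLabel q
    let _ := instFintypeLabel r
    inferInstanceAs (Fintype (Option (p.Label ⊕ (q.Label ⊕ r.Label))))
  | loop _ _ p q r =>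
    let _ := instFintypeLabel p
    let _ := instFintypeLabel q
    let _ := instFintypeLabel r
    inferInstanceAs (Fintype (Option (p.Label ⊕ (q.Label ⊕ r.Label))))

/-- The label at which a program starts. -/
def entry : (p : Prog) → p.Label
  | skip => ()
  | push _ _ => ()
  | seq p _ => Sum.inl p.entry
  | pop _ _ _ _ => none
  | loop _ _ _ _ _ => none

/-- The statements of machines for programs. -/
abbrev MachineStmt (Λ : Type) : Type := Turing.TM2.Stmt (fun _ : StackName => Bool) Λ (Option Bool)

/-- A case distinction on the bit that was popped last. -/
def branch {Λ : Type} (l₀ l₁ l₂ : Λ) : Option Bool → Λ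
  | none => l₀
  | some false => l₁
  | some true => l₂

/-- The statements of a program, for a given embedding of the labels and a given exit. -/
def code {Λ : Type} : (p : Prog) → (p.Label → Λ) → Λ → p.Label → MachineStmt Λ
  | skip, _, ex => fun _ => .goto fun _ => ex
  | push k v, _, ex => fun _ => .push k (fun _ => v) (.goto fun _ => ex)
  | seq p q, em, ex => fun
    | .inl l => p.code (fun l => em (.inl l)) (em (.inr q.entry)) l
    | .inr l => q.code (fun l => em (.inr l)) ex l
  | pop k p q r, em, ex => fun
    | none => .pop k (fun _ v => v) (.goto (branch (em (some (.inl p.entry)))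
        (em (some (.inr (.inl q.entry)))) (em (some (.inr (.inr r.entry))))))
    | some (.inl l) => p.code (fun l => em (some (.inl l))) ex l
    | some (.inr (.inl l)) => q.code (fun l => em (some (.inr (.inl l)))) ex l
    | some (.inr (.inr l)) => r.code (fun l => em (some (.inr (.inr l)))) ex l
  | loop k c p q r, em, ex => fun
    | none => .pop k (fun _ v => v) (.goto (branch (em (some (.inl p.entry)))
        (em (some (.inr (.inl q.entry)))) (em (some (.inr (.inr r.entry))))))
    | some (.inl l) => p.code (fun l => em (some (.inl l))) ex l
    | some (.inr (.inl l)) =>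
        q.code (fun l => em (some (.inr (.inl l)))) (if c then em none else ex) l
    | some (.inr (.inr l)) => r.code (fun l => em (some (.inr (.inr l)))) (em none) l

/-- The configuration of a machine with a given label, last bit popped, and store. -/
def config {Λ : Type} (l : Λ) (v : Option Bool) (S : Store) :
    Turing.TM2.Cfg (fun _ : StackName => Bool) Λ (Option Bool) :=
  ⟨some l, v, S.get⟩

/-- `n` steps of a machine. -/
def run {Λ : Type} (M : Λ → MachineStmt Λ) (n : ℕ)
    (c : Option (Turing.TM2.Cfg (fun _ : StackName => Bool) Λ (Option Bool))) :
    Option (Turing.TM2.Cfg (fun _ : StackName => Bool) Λ (Option Bool)) :=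
  (flip bind (Turing.TM2.step M))^[n] c

/-- The summand of the earlier run stands on the right, which is why `Exec` counts steps as `n + m`
and `n + (m + 1)`. -/
theorem run_add {Λ : Type} (M : Λ → MachineStmt Λ) (m n : ℕ) (c) :
    run M (n + m) c = run M n (run M m c) := Function.iterate_add_apply _ _ _ _

theorem run_one {Λ : Type} (M : Λ → MachineStmt Λ) (c) :
    run M 1 (some c) = Turing.TM2.step M c := rfl

theorem run_pop {Λ : Type} {M : Λ → MachineStmt Λ} {l l₀ l₁ l₂ : Λ} {k : StackName}
    (h : M l = .pop k (fun _ v => v) (.goto (branch l₀ l₁ l₂))) (v : Option Bool) (S : Store) :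
    run M 1 (some (config l v S)) =
      some (config (branch l₀ l₁ l₂ (S.get k).head?) (S.get k).head?
        (S.set k (S.get k).tail)) := by
  simp [run_one, config, h, Store.get_set]

theorem Store.set_get_nil {S : Store} {k : StackName} (h : S.get k = []) : S.set k [] = S := by
  cases k <;> simp only [Store.get] at h <;> simp [Store.set, ← h]

/-- The machine for a program simulates it. -/
theorem Exec.run {Λ : Type} {M : Λ → MachineStmt Λ} {p : Prog} {S S' : Store} {n : ℕ}
    (h : Exec p S S' n) {em : p.Label → Λ} {ex : Λ} (hM : ∀ l, M (em l) = p.code em ex l)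
    (v : Option Bool) :
    ∃ v', run M n (some (config (em p.entry) v S)) = some (config ex v' S') := by
  -- Embedding and exit must vary: a subprogram is embedded through an injection of its labels, and
  -- its exit is the entry of the next part, the head of the loop, or the exit of the whole program.
  induction h generalizing ex v with
  | skip S =>
    refine ⟨v, ?_⟩
    simp [run_one, config, hM, code]
  | push k w S =>
    refine ⟨v, ?_⟩
    simp [run_one, config, hM, code, Store.get_set]
  | @seq p q S S' S'' m n _ _ ih₁ ih₂ =>
    obtain ⟨v₁, h₁⟩ := ih₁ (em := fun l => em (.inl l)) (ex := em (.inr q.entry))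
      (fun l => hM (.inl l)) v
    obtain ⟨v₂, h₂⟩ := ih₂ (em := fun l => em (.inr l)) (ex := ex) (fun l => hM (.inr l)) v₁
    exact ⟨v₂, by rw [run_add]; exact (congrArg _ h₁).trans h₂⟩
  | @pop_nil k p q r S S' n hk _ ih =>
    obtain ⟨v₁, h₁⟩ := ih (em := fun l => em (some (.inl l))) (ex := ex)
      (fun l => hM (some (.inl l))) none
    refine ⟨v₁, ?_⟩
    rw [run_add, entry, run_pop (hM none), hk]
    simpa [branch, Store.set_get_nil hk] using h₁
  | @pop_false k p q r S S' n l hk _ ih =>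
    obtain ⟨v₁, h₁⟩ := ih (em := fun l => em (some (.inr (.inl l)))) (ex := ex)
      (fun l => hM (some (.inr (.inl l)))) (some false)
    refine ⟨v₁, ?_⟩
    rw [run_add, entry, run_pop (hM none), hk]
    simpa [branch] using h₁
  | @pop_true k p q r S S' n l hk _ ih =>
    obtain ⟨v₁, h₁⟩ := ih (em := fun l => em (some (.inr (.inr l)))) (ex := ex)
      (fun l => hM (some (.inr (.inr l)))) (some true)
    refine ⟨v₁, ?_⟩
    rw [run_add, entry, run_pop (hM none), hk]
    simpa [branch] using h₁
  | @loop_nil k c p q r S S' n hk _ ih =>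
    obtain ⟨v₁, h₁⟩ := ih (em := fun l => em (some (.inl l))) (ex := ex)
      (fun l => hM (some (.inl l))) none
    refine ⟨v₁, ?_⟩
    rw [run_add, entry, run_pop (hM none), hk]
    simpa [branch, Store.set_get_nil hk] using h₁
  | @loop_exit k p q r S S' n l hk _ ih =>
    obtain ⟨v₁, h₁⟩ := ih (em := fun l => em (some (.inr (.inl l)))) (ex := ex)
      (fun l => hM (some (.inr (.inl l)))) (some false)
    refine ⟨v₁, ?_⟩
    rw [run_add, entry, run_pop (hM none), hk]
    simpa [branch] using h₁
  | @loop_false k p q r S S' S'' m n l hk _ _ ih₁ ih₂ =>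
    obtain ⟨v₁, h₁⟩ := ih₁ (em := fun l => em (some (.inr (.inl l)))) (ex := em none)
      (fun l => hM (some (.inr (.inl l)))) (some false)
    obtain ⟨v₂, h₂⟩ := ih₂ hM v₁
    refine ⟨v₂, ?_⟩
    rw [run_add, run_add, entry, run_pop (hM none), hk]
    simp only [List.head?_cons, branch, List.tail_cons]
    rw [h₁]
    exact h₂
  | @loop_true k c p q r S S' S'' m n l hk _ _ ih₁ ih₂ =>
    obtain ⟨v₁, h₁⟩ := ih₁ (em := fun l => em (some (.inr (.inr l)))) (ex := em none)
      (fun l => hM (some (.inr (.inr l)))) (some true)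
    obtain ⟨v₂, h₂⟩ := ih₂ hM v₁
    refine ⟨v₂, ?_⟩
    rw [run_add, run_add, entry, run_pop (hM none), hk]
    simp only [List.head?_cons, branch, List.tail_cons]
    rw [h₁]
    exact h₂

/-- The statements of the Turing machine for a program. -/
def machineCode (p : Prog) : Option p.Label → MachineStmt (Option p.Label)
  -- `Turing.haltList` requires the initial internal state, so the last popped bit is erased before
  -- halting. This is the one step that `polyTimeComputable` adds to `time`.
  | none => .load (fun _ => none) .halt
  | some l => p.code some none l

/-- The Turing machine for a program, with input on the stack `a` and output on the stack `o`. -/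
noncomputable def machine (p : Prog) : Turing.FinTM2 where
  K := StackName
  k₀ := .a
  k₁ := .o
  Γ _ := Bool
  Λ := Option p.Label
  main := some p.entry
  ΛFin := inferInstance
  σ := Option Bool
  initialState := none
  σFin := inferInstance
  Γk₀Fin := inferInstanceAs (Fintype Bool)
  m := p.machineCode

/-- `Reach p S S' n`: the program `p` leads from the store `S` to the store `S'` in at most `n`
steps. -/
def Reach (p : Prog) (S S' : Store) (n : ℕ) : Prop := ∃ m ≤ n, Exec p S S' m

/-- A function is polynomial-time computable if a structured program computes it in polynomial
time. -/
theorem polyTimeComputable {f : List Bool → List Bool} (p : Prog) (time : Polynomial ℕ)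
    (h : ∀ x, p.Reach ⟨x, [], [], [], [], [], [], [], []⟩ ⟨[], [], [], [], [], [], [], [], f x⟩
      (time.eval x.length)) : PolyTimeComputable f := by
  refine ⟨{ tm := p.machine, inputAlphabet := Equiv.refl _, outputAlphabet := Equiv.refl _,
            time := time + 1, outputsFun := fun x => ?_ }⟩
  have key : ∃ n ≤ (time + 1).eval x.length,
      (flip bind p.machine.step)^[n] (some (Turing.initList p.machine x)) =
        some (Turing.haltList p.machine (f x)) := by
    obtain ⟨n, hn, he⟩ := h x
    refine ⟨1 + n, by simp; omega, ?_⟩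
    obtain ⟨v, hv⟩ := he.run (M := p.machineCode) (em := some) (ex := none) (fun l => rfl) none
    have e1 : Turing.initList p.machine x =
        config (some p.entry) none ⟨x, [], [], [], [], [], [], [], []⟩ := by
      simp only [Turing.initList, config]
      congr 1
      funext k
      cases k <;> rfl
    have e2 : Turing.haltList p.machine (f x) =
        ⟨none, none, (⟨[], [], [], [], [], [], [], [], f x⟩ : Store).get⟩ := by
      simp only [Turing.haltList]
      congr 1
      funext k
      cases k <;> rfl
    rw [e1, e2]
    exact (run_add p.machineCode n 1 _).trans ((congrArg _ hv).trans rfl)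
  exact
    { steps := key.choose
      evals_in_steps := by
        have h2 := key.choose_spec.2
        have e (l : List Bool) : l.map (Equiv.refl Bool).invFun = l := List.map_id l
        erw [e, e]
        exact h2
      steps_le_m := key.choose_spec.1 }

/-! ### Composition rules for upper bounds on running times. -/

namespace Reach

variable {p q r : Prog} {S S' S'' : Store} {l m n : ℕ} {k : StackName}

theorem mono (h : p.Reach S S' m) (hmn : m ≤ n) : p.Reach S S' n :=
  let ⟨i, hi, he⟩ := h
  ⟨i, hi.trans hmn, he⟩

theorem skip : Prog.skip.Reach S S 1 := ⟨1, le_rfl, .skip S⟩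

theorem push {v : Bool} : (Prog.push k v).Reach S (S.set k (v :: S.get k)) 1 :=
  ⟨1, le_rfl, .push k v S⟩

theorem seq (hp : p.Reach S S' m) (hq : q.Reach S' S'' n) : (p.seq q).Reach S S'' (m + n) :=
  let ⟨i, hi, he⟩ := hp
  let ⟨j, hj, hf⟩ := hq
  ⟨j + i, by omega, .seq he hf⟩

theorem pop_nil (hk : S.get k = []) (h : p.Reach S S' n) :
    (Prog.pop k p q r).Reach S S' (n + 1) :=
  let ⟨i, hi, he⟩ := h
  ⟨i + 1, by omega, .pop_nil hk he⟩

theorem pop_false {w : List Bool} (hk : S.get k = false :: w) (h : q.Reach (S.set k w) S' n) :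
    (Prog.pop k p q r).Reach S S' (n + 1) :=
  let ⟨i, hi, he⟩ := h
  ⟨i + 1, by omega, .pop_false hk he⟩

theorem pop_true {w : List Bool} (hk : S.get k = true :: w) (h : r.Reach (S.set k w) S' n) :
    (Prog.pop k p q r).Reach S S' (n + 1) :=
  let ⟨i, hi, he⟩ := h
  ⟨i + 1, by omega, .pop_true hk he⟩

variable {c : Bool}

theorem loop_nil (hk : S.get k = []) (h : p.Reach S S' n) :
    (Prog.loop k c p q r).Reach S S' (n + 1) :=
  let ⟨i, hi, he⟩ := h
  ⟨i + 1, by omega, .loop_nil hk he⟩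

theorem loop_exit {w : List Bool} (hk : S.get k = false :: w) (h : q.Reach (S.set k w) S' n) :
    (Prog.loop k false p q r).Reach S S' (n + 1) :=
  let ⟨i, hi, he⟩ := h
  ⟨i + 1, by omega, .loop_exit hk he⟩

theorem loop_false {w : List Bool} (hk : S.get k = false :: w) (h : q.Reach (S.set k w) S' m)
    (h' : (Prog.loop k true p q r).Reach S' S'' n) :
    (Prog.loop k true p q r).Reach S S'' (m + n + 1) :=
  let ⟨i, hi, he⟩ := h
  let ⟨j, hj, hf⟩ := h'
  ⟨j + (i + 1), by omega, .loop_false hk he hf⟩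

theorem loop_true {w : List Bool} (hk : S.get k = true :: w) (h : r.Reach (S.set k w) S' m)
    (h' : (Prog.loop k c p q r).Reach S' S'' n) :
    (Prog.loop k c p q r).Reach S S'' (m + n + 1) :=
  let ⟨i, hi, he⟩ := h
  let ⟨j, hj, hf⟩ := h'
  ⟨j + (i + 1), by omega, .loop_true hk he hf⟩

end Reach

end Prog

/-! ### Cells of six tiles -/

/-- The kinds of the cells from which the puzzles are built. -/
inductive CellKind : Type
  | cross | or | eq | neq | one
  deriving DecidableEq

instance : Fintype CellKind where
  elems := {.cross, .or, .eq, .neq, .one}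
  complete k := by cases k <;> decide

namespace CellKind

/-- The six tiles of a cell. -/
def tile : CellKind → Fin 6 → TantrixTile
  | cross =>
    ![⟨.sint, .green, .yellow, .red, by decide, by decide⟩,
      ⟨.rond, .red, .yellow, .green, by decide, by decide⟩,
      ⟨.rond, .red, .yellow, .green, by decide, by decide⟩,
      ⟨.rond, .yellow, .green, .blue, by decide, by decide⟩,
      ⟨.sint, .green, .yellow, .red, by decide, by decide⟩,
      ⟨.rond, .yellow, .green, .blue, by decide, by decide⟩]
  | or =>
    ![⟨.sint, .red, .blue, .yellow, by decide, by decide⟩,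
      ⟨.sint, .yellow, .blue, .red, by decide, by decide⟩,
      ⟨.sint, .blue, .red, .yellow, by decide, by decide⟩,
      ⟨.rond, .red, .yellow, .blue, by decide, by decide⟩,
      ⟨.sint, .red, .yellow, .blue, by decide, by decide⟩,
      ⟨.brid, .yellow, .red, .blue, by decide, by decide⟩]
  | eq =>
    ![⟨.sint, .red, .yellow, .blue, by decide, by decide⟩,
      ⟨.sint, .red, .yellow, .blue, by decide, by decide⟩,
      ⟨.sint, .blue, .red, .yellow, by decide, by decide⟩,
      ⟨.brid, .yellow, .red, .blue, by decide, by decide⟩,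
      ⟨.rond, .red, .blue, .yellow, by decide, by decide⟩,
      ⟨.rond, .red, .yellow, .blue, by decide, by decide⟩]
  | neq =>
    ![⟨.sint, .red, .yellow, .blue, by decide, by decide⟩,
      ⟨.sint, .red, .blue, .yellow, by decide, by decide⟩,
      ⟨.sint, .yellow, .red, .blue, by decide, by decide⟩,
      ⟨.brid, .blue, .red, .yellow, by decide, by decide⟩,
      ⟨.chin, .yellow, .red, .blue, by decide, by decide⟩,
      ⟨.rond, .red, .blue, .yellow, by decide, by decide⟩]
  | one =>
    ![⟨.chin, .blue, .red, .yellow, by decide, by decide⟩,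
      ⟨.chin, .blue, .red, .yellow, by decide, by decide⟩,
      ⟨.chin, .blue, .red, .yellow, by decide, by decide⟩,
      ⟨.sint, .red, .blue, .yellow, by decide, by decide⟩,
      ⟨.brid, .yellow, .red, .blue, by decide, by decide⟩,
      ⟨.chin, .blue, .red, .yellow, by decide, by decide⟩]

/-- The relation that a cell of a given kind imposes on the bit of its column, and the bits of its
row on the left and on the right. -/
def Rel : CellKind → Bool → Bool → Bool → Prop
  | cross, _, w, e => w = e
  | or, z, w, e => w = (z || e)
  | eq, z, w, e => w = z ∧ e = z
  | neq, z, w, e => w = !z ∧ e = !z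
  | one, z, w, e => z = true ∧ w = true ∧ e = true

instance (k : CellKind) (z w e : Bool) : Decidable (k.Rel z w e) := by
  cases k <;> unfold Rel <;> infer_instance

/-- The orientations of the six tiles for given bits of the column and the row. -/
def rotation : CellKind → Bool → Bool → Bool → Fin 6 → Fin 6
  -- Bits that `Rel` determines from the others are not inspected; only triples that satisfy `Rel`
  -- matter.
  | cross, false, false, _ => ![2, 1, 4, 3, 5, 0]
  | cross, true, false, _ => ![2, 2, 5, 4, 5, 1]
  | cross, false, true, _ => ![3, 0, 3, 3, 0, 0]
  | cross, true, true, _ => ![5, 3, 0, 5, 2, 2]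
  | or, true, _, false => ![0, 1, 0, 4, 0, 4]
  | or, false, _, false => ![1, 0, 2, 1, 4, 3]
  | or, true, _, true => ![2, 1, 0, 5, 0, 4]
  | or, false, _, true => ![2, 2, 1, 0, 2, 3]
  | eq, false, _, _ => ![1, 0, 0, 0, 3, 4]
  | eq, true, _, _ => ![3, 4, 5, 5, 0, 2]
  | neq, true, _, _ => ![0, 0, 0, 0, 3, 4]
  | neq, false, _, _ => ![3, 5, 3, 5, 1, 1]
  | one, _, _, _ => ![1, 4, 1, 5, 5, 1]

end CellKind

/-- The horizontal positions of the six tiles in a cell. -/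
def boxX : Fin 6 → ℕ := ![2, 1, 1, 2, 0, 0]

/-- The vertical positions of the six tiles in a cell. -/
def boxY : Fin 6 → ℕ := ![1, 1, 0, 0, 0, 1]

/-- The colors that represent a bit in a row. -/
def rowColor (h : Bool) : TantrixColor := if h then .yellow else .red

/-- The colors that represent a bit in a column. -/
def columnColor (z : Bool) : TantrixColor := if z then .blue else .yellow

theorem rowColor_injective : Function.Injective rowColor := by decide

theorem columnColor_injective : Function.Injective columnColor := by decide

namespace CellKind

/-- The colors match at the joint edges inside of a cell. -/
def Consistent (k : CellKind) (ρ : Fin 6 → Fin 6) : Prop :=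
  ∀ (a b i : Fin 6), (boxX b : ℤ) = boxX a + (hexDir i).1 → (boxY b : ℤ) = boxY a + (hexDir i).2 →
    (k.tile a).color (ρ a) i = (k.tile b).color (ρ b) (i + 3)

-- The hypotheses are the nine joint edges inside of the 3 by 2 box. Each stands right behind the
-- quantifier of the later of its two tiles, so that the evaluation drops a partial choice of
-- orientations at the first mismatch instead of running through all `6 ^ 6`.
set_option synthInstance.maxHeartbeats 400000 in
set_option synthInstance.maxSize 2000 in
theorem exists_of_edges : ∀ (k : CellKind) (r₀ r₁ : Fin 6),
    (k.tile 0).color r₀ 5 = (k.tile 1).color r₁ 2 → ∀ r₂,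
    (k.tile 0).color r₀ 4 = (k.tile 2).color r₂ 1 →
    (k.tile 1).color r₁ 3 = (k.tile 2).color r₂ 0 → ∀ r₃,
    (k.tile 0).color r₀ 3 = (k.tile 3).color r₃ 0 →
    (k.tile 2).color r₂ 2 = (k.tile 3).color r₃ 5 → ∀ r₄,
    (k.tile 1).color r₁ 4 = (k.tile 4).color r₄ 1 →
    (k.tile 2).color r₂ 5 = (k.tile 4).color r₄ 2 → ∀ r₅,
    (k.tile 1).color r₁ 5 = (k.tile 5).color r₅ 2 →
    (k.tile 4).color r₄ 0 = (k.tile 5).color r₅ 3 →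
    ∃ z w e, k.Rel z w e ∧ k.rotation z w e = ![r₀, r₁, r₂, r₃, r₄, r₅] := by
  decide +kernel

/-- The solutions of a cell are given by the values of the bits. -/
theorem consistent_iff (k : CellKind) (ρ : Fin 6 → Fin 6) :
    k.Consistent ρ ↔ ∃ z w e, k.Rel z w e ∧ k.rotation z w e = ρ := by
  constructor
  · intro h
    have e : ρ = ![ρ 0, ρ 1, ρ 2, ρ 3, ρ 4, ρ 5] := by
      funext i
      fin_cases i <;> rfl
    rw [e]
    exact exists_of_edges k _ _ (h 0 1 5 (by decide) (by decide)) _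
      (h 0 2 4 (by decide) (by decide)) (h 1 2 3 (by decide) (by decide)) _
      (h 0 3 3 (by decide) (by decide)) (h 2 3 2 (by decide) (by decide)) _
      (h 1 4 4 (by decide) (by decide)) (h 2 4 5 (by decide) (by decide)) _
      (h 1 5 5 (by decide) (by decide)) (h 4 5 0 (by decide) (by decide))
  · rintro ⟨z, w, e, h, rfl⟩
    revert h
    revert k z w e
    unfold Consistent
    decide +kernel

/-- The west, east and north ports of `one` show colors other than those of its bits; only its south
port is meant to be used. -/
theorem color_west : ∀ (k : CellKind) (z w e : Bool), k.Rel z w e → k ≠ one →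
    (k.tile 4).color (k.rotation z w e 4) 4 = rowColor w := by
  decide +kernel

theorem color_east : ∀ (k : CellKind) (z w e : Bool), k.Rel z w e → k ≠ one →
    (k.tile 0).color (k.rotation z w e 0) 1 = rowColor e := by
  decide +kernel

theorem color_north : ∀ (k : CellKind) (z w e : Bool), k.Rel z w e → k ≠ one →
    (k.tile 5).color (k.rotation z w e 5) 0 = columnColor z := by
  decide +kernel

theorem color_south : ∀ (k : CellKind) (z w e : Bool), k.Rel z w e →
    (k.tile 3).color (k.rotation z w e 3) 3 = columnColor z := by
  decide +kernel

theorem rotation_injective : ∀ (k : CellKind) (z w e z' w' e' : Bool), k.Rel z w e →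
    k.Rel z' w' e' → k.rotation z w e = k.rotation z' w' e' → z = z' ∧ w = w' ∧ e = e' := by
  decide +kernel

end CellKind

/-- The position of a tile of the cell with coordinates `c`. -/
def tilePos (c : ℕ × ℕ) (a : Fin 6) : ℤ × ℤ :=
  (3 * c.1 + 5 * c.2 + boxX a, 2 * c.1 + boxY a)

theorem boxX_le (a : Fin 6) : boxX a ≤ 2 := by revert a; decide

theorem boxY_le (a : Fin 6) : boxY a ≤ 1 := by revert a; decide

theorem box_injective : ∀ a b : Fin 6, boxX a = boxX b → boxY a = boxY b → a = b := by decide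

/-- Boxes have height 2, so the second coordinate gives `c.1`; then the first one gives `c.2`,
because the shift 5 exceeds the width 3. -/
theorem tilePos_injective {c c' : ℕ × ℕ} {a b : Fin 6} (h : tilePos c a = tilePos c' b) :
    c = c' ∧ a = b := by
  simp only [tilePos, Prod.mk.injEq] at h
  have h1 := boxX_le a
  have h2 := boxX_le b
  have h3 := boxY_le a
  have h4 := boxY_le b
  refine ⟨Prod.ext (by omega) (by omega), box_injective a b (by omega) (by omega)⟩

theorem hexDir_bounds : ∀ i : Fin 6, -1 ≤ (hexDir i).1 ∧ (hexDir i).1 ≤ 1 ∧ -1 ≤ (hexDir i).2 ∧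
    (hexDir i).2 ≤ 1 := by decide

-- Here `p` and `q` are differences of cell coordinates. The shifts `(3, 2)` and `(5, 0)` are such
-- that neighboring boxes have a single joint edge: east to west for `(1, 0)`, and south to north
-- for `(-1, 1)`.
set_option synthInstance.maxHeartbeats 400000 in
set_option synthInstance.maxSize 2000 in
theorem adjacent_aux : ∀ (a b i : Fin 6), ∀ p ∈ ([-1, 0, 1] : List ℤ), ∀ q ∈ ([-1, 0, 1] : List ℤ),
    3 * p + 5 * q + boxX b = boxX a + (hexDir i).1 → 2 * p + boxY b = boxY a + (hexDir i).2 →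
    (p = 0 ∧ q = 0) ∨ (p = 1 ∧ q = 0 ∧ a = 0 ∧ b = 4 ∧ i = 1) ∨
    (p = -1 ∧ q = 0 ∧ a = 4 ∧ b = 0 ∧ i = 4) ∨ (p = -1 ∧ q = 1 ∧ a = 3 ∧ b = 5 ∧ i = 3) ∨
    (p = 1 ∧ q = -1 ∧ a = 5 ∧ b = 3 ∧ i = 0) := by
  decide +kernel

/-- Two tiles are adjacent only inside of a cell, or at a port of two neighboring cells. -/
theorem adjacent_cases {c c' : ℕ × ℕ} {a b i : Fin 6}
    (h : tilePos c' b = tilePos c a + hexDir i) :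
    (c = c' ∧ (boxX b : ℤ) = boxX a + (hexDir i).1 ∧ (boxY b : ℤ) = boxY a + (hexDir i).2) ∨
    (c' = (c.1 + 1, c.2) ∧ a = 0 ∧ b = 4 ∧ i = 1) ∨
    (c = (c'.1 + 1, c'.2) ∧ a = 4 ∧ b = 0 ∧ i = 4) ∨
    (c.1 = c'.1 + 1 ∧ c'.2 = c.2 + 1 ∧ a = 3 ∧ b = 5 ∧ i = 3) ∨
    (c'.1 = c.1 + 1 ∧ c.2 = c'.2 + 1 ∧ a = 5 ∧ b = 3 ∧ i = 0) := by
  obtain ⟨X, Y⟩ := c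
  obtain ⟨X', Y'⟩ := c'
  simp only [tilePos, Prod.ext_iff, Prod.fst_add, Prod.snd_add] at h ⊢
  have h1 := boxX_le a
  have h2 := boxX_le b
  have h3 := boxY_le a
  have h4 := boxY_le b
  obtain ⟨h5, h6, h7, h8⟩ := hexDir_bounds i
  -- The second coordinates give `|2 * (X' - X)| ≤ 2`, and then the first ones give `|5 * (Y' - Y)|
  -- ≤ 6`, so both differences are in `{-1, 0, 1}`.
  have key := adjacent_aux a b i (X' - X) (by simp; omega) (Y' - Y) (by simp; omega)
    (by omega) (by omega)
  rcases key with h | h | h | h | h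
  · left; omega
  · right; left; exact ⟨by omega, h.2.2⟩
  · right; right; left; exact ⟨by omega, h.2.2⟩
  · right; right; right; left; exact ⟨by omega, by omega, h.2.2⟩
  · right; right; right; right; exact ⟨by omega, by omega, h.2.2⟩

/-! ### Puzzles that consist of cells -/

/-- The cells of a diagram: their coordinates and kinds. -/
abbrev Diagram.Cell (G : ℕ × ℕ → Option CellKind) : Type :=
  {p : (ℕ × ℕ) × CellKind // G p.1 = some p.2}

namespace Diagram

variable {G : ℕ × ℕ → Option CellKind}

/-- A labeling of the cells by a bit of the column and two bits of the row is valid if it satisfies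
the relations of the cells, and neighboring cells agree on their common bits. -/
structure Valid (L : Cell G → Bool × Bool × Bool) : Prop where
  rel : ∀ c : Cell G, c.1.2.Rel (L c).1 (L c).2.1 (L c).2.2
  row : ∀ c c' : Cell G, c'.1.1 = (c.1.1.1 + 1, c.1.1.2) → (L c).2.2 = (L c').2.1
  column : ∀ c c' : Cell G, c.1.1.1 = c'.1.1.1 + 1 → c'.1.1.2 = c.1.1.2 + 1 → (L c).1 = (L c').1

/-- A puzzle realizes a diagram if it consists of the tiles of the cells. -/
def Realizes (A : TRPInstance) (G : ℕ × ℕ → Option CellKind) : Prop :=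
  ∀ v t, A.tile v = some t ↔ ∃ c k a, G c = some k ∧ v = tilePos c a ∧ t = k.tile a

variable {A : TRPInstance}

theorem Realizes.tile_tilePos (hA : Realizes A G) (c : Cell G) (a : Fin 6) :
    A.tile (tilePos c.1.1 a) = some (c.1.2.tile a) :=
  (hA _ _).2 ⟨_, _, _, c.2, rfl, rfl⟩

/-- The place of a tile in the shape of the puzzle. -/
def Realizes.place (hA : Realizes A G) (p : Cell G × Fin 6) : A.shape :=
  ⟨tilePos p.1.1.1 p.2, by
    change (A.tile _).isSome
    rw [hA.tile_tilePos]; rfl⟩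

theorem Realizes.place_bijective (hA : Realizes A G) : Function.Bijective hA.place := by
  constructor
  · rintro ⟨⟨⟨c, k⟩, hc⟩, a⟩ ⟨⟨⟨c', k'⟩, hc'⟩, a'⟩ h
    obtain ⟨h1, rfl⟩ := tilePos_injective (congrArg Subtype.val h)
    simp only at h1 hc hc'
    subst h1
    rw [hc] at hc'
    cases hc'
    rfl
  · rintro ⟨v, hv⟩
    obtain ⟨t, ht⟩ := Option.isSome_iff_exists.1 hv
    obtain ⟨c, k, a, h1, rfl, -⟩ := (hA v t).1 ht
    exact ⟨⟨⟨(c, k), h1⟩, a⟩, rfl⟩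

theorem Realizes.tileOn_place (hA : Realizes A G) (c : Cell G) (a : Fin 6) :
    A.tileOn (hA.place (c, a)) = c.1.2.tile a := by
  apply Option.some_injective
  exact (Option.some_get _).trans (hA.tile_tilePos c a)

theorem Realizes.isSolution_iff (hA : Realizes A G) (r : A.shape → Fin 6) :
    A.IsSolution r ↔ ∀ (c c' : Cell G) (a b i : Fin 6),
      tilePos c'.1.1 b = tilePos c.1.1 a + hexDir i →
        (c.1.2.tile a).color (r (hA.place (c, a))) i =
          (c'.1.2.tile b).color (r (hA.place (c', b))) (i + 3) := by
  constructor
  · intro h c c' a b i hi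
    have := h (hA.place (c, a)) (hA.place (c', b)) i hi
    rwa [hA.tileOn_place, hA.tileOn_place] at this
  · intro h v w i hi
    obtain ⟨⟨c, a⟩, rfl⟩ := hA.place_bijective.2 v
    obtain ⟨⟨c', b⟩, rfl⟩ := hA.place_bijective.2 w
    rw [hA.tileOn_place, hA.tileOn_place]
    exact h c c' a b i hi

/-- The only cell of the kind `one` is the cell `(1, 0)`, and it has no neighbors in its row. -/
def Isolated (G : ℕ × ℕ → Option CellKind) : Prop :=
  (∀ c, G c = some .one → c = (1, 0)) ∧ G (0, 0) = none ∧ G (2, 0) = none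

/-- The orientations of the tiles that correspond to a labeling. -/
noncomputable def Realizes.rotations (hA : Realizes A G) (L : Cell G → Bool × Bool × Bool)
    (v : A.shape) : Fin 6 :=
  let p := (Equiv.ofBijective _ hA.place_bijective).symm v
  p.1.1.2.rotation (L p.1).1 (L p.1).2.1 (L p.1).2.2 p.2

theorem Realizes.rotations_place (hA : Realizes A G) (L : Cell G → Bool × Bool × Bool)
    (c : Cell G) (a : Fin 6) :
    hA.rotations L (hA.place (c, a)) = c.1.2.rotation (L c).1 (L c).2.1 (L c).2.2 a := by
  have : (Equiv.ofBijective _ hA.place_bijective).symm (hA.place (c, a)) = (c, a) :=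
    (Equiv.ofBijective _ hA.place_bijective).symm_apply_apply (c, a)
  simp only [rotations, this]

theorem cell_ext {c c' : Cell G} (h : c.1.1 = c'.1.1) : c = c' := by
  obtain ⟨⟨c, k⟩, hc⟩ := c
  obtain ⟨⟨c', k'⟩, hc'⟩ := c'
  simp only at h hc hc'
  subst h
  rw [hc] at hc'
  cases hc'
  rfl

theorem Isolated.row_ne (hG : Isolated G) {c c' : Cell G}
    (h : c'.1.1 = (c.1.1.1 + 1, c.1.1.2)) : c.1.2 ≠ .one ∧ c'.1.2 ≠ .one := by
  obtain ⟨⟨c, k⟩, hc⟩ := c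
  obtain ⟨⟨c', k'⟩, hc'⟩ := c'
  simp only at h hc hc' ⊢
  subst h
  constructor
  · rintro rfl
    have := hG.1 _ hc
    subst this
    rw [hG.2.2] at hc'
    cases hc'
  · rintro rfl
    have := hG.1 _ hc'
    obtain ⟨c1, c2⟩ := c
    simp only [Prod.mk.injEq, Nat.add_eq_right] at this
    obtain ⟨rfl, rfl⟩ := this
    rw [hG.2.1] at hc
    cases hc

/-- As the cell `one` lies in row 0, it can only be the upper of two neighbors in a column, where
its usable south port counts. -/
theorem Isolated.column_ne (hG : Isolated G) {c c' : Cell G}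
    (h : c'.1.1.2 = c.1.1.2 + 1) : c'.1.2 ≠ .one := by
  intro h1
  have h2 := c'.2
  rw [h1] at h2
  have := hG.1 _ h2
  rw [this] at h
  simp at h

theorem tilePos_east (c : ℕ × ℕ) : tilePos (c.1 + 1, c.2) 4 = tilePos c 0 + hexDir 1 := by
  ext <;> simp [tilePos, boxX, boxY, hexDir] <;> ring

theorem tilePos_south {c c' : ℕ × ℕ} (h : c.1 = c'.1 + 1) (h' : c'.2 = c.2 + 1) :
    tilePos c' 5 = tilePos c 3 + hexDir 3 := by
  ext <;> simp [tilePos, boxX, boxY, hexDir, h, h'] <;> ring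

/-- The orientations that correspond to a valid labeling are a solution. -/
theorem Valid.isSolution (hG : Isolated G) (hA : Realizes A G) {L : Cell G → Bool × Bool × Bool}
    (hL : Valid L) : A.IsSolution (hA.rotations L) := by
  rw [hA.isSolution_iff]
  intro c c' a b i hi
  rw [hA.rotations_place, hA.rotations_place]
  rcases adjacent_cases hi with ⟨h, h1, h2⟩ | ⟨h, rfl, rfl, rfl⟩ | ⟨h, rfl, rfl, rfl⟩ |
    ⟨h, h', rfl, rfl, rfl⟩ | ⟨h, h', rfl, rfl, rfl⟩
  · obtain rfl := cell_ext h
    exact (c.1.2.consistent_iff _).2 ⟨_, _, _, hL.rel c, rfl⟩ a b i h1 h2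
  · obtain ⟨n1, n2⟩ := hG.row_ne h
    rw [CellKind.color_east _ _ _ _ (hL.rel c) n1, hL.row c c' h]
    exact (CellKind.color_west _ _ _ _ (hL.rel c') n2).symm
  · obtain ⟨n1, n2⟩ := hG.row_ne h
    rw [CellKind.color_west _ _ _ _ (hL.rel c) n2, ← hL.row c' c h]
    exact (CellKind.color_east _ _ _ _ (hL.rel c') n1).symm
  · rw [CellKind.color_south _ _ _ _ (hL.rel c), hL.column c c' h h']
    exact (CellKind.color_north _ _ _ _ (hL.rel c') (hG.column_ne h')).symm
  · rw [CellKind.color_north _ _ _ _ (hL.rel c) (hG.column_ne h'), ← hL.column c' c h h']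
    exact (CellKind.color_south _ _ _ _ (hL.rel c')).symm

/-- Every solution corresponds to a valid labeling. -/
theorem Realizes.exists_valid (hG : Isolated G) (hA : Realizes A G) {r : A.shape → Fin 6}
    (hr : A.IsSolution r) : ∃ L : Cell G → Bool × Bool × Bool, Valid L ∧ hA.rotations L = r := by
  rw [hA.isSolution_iff] at hr
  have h1 : ∀ c : Cell G, ∃ z w e, c.1.2.Rel z w e ∧
      c.1.2.rotation z w e = fun a => r (hA.place (c, a)) := by
    intro c
    rw [← CellKind.consistent_iff]
    intro a b i hx hy
    refine hr c c a b i (Prod.ext ?_ ?_)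
    · simp only [tilePos, Prod.fst_add]; omega
    · simp only [tilePos, Prod.snd_add]; omega
  -- The states of the cells are found separately; agreement at the ports then follows because the
  -- port colors are injective in the bits.
  choose z w e hrel hrot using h1
  refine ⟨fun c => (z c, w c, e c), ⟨hrel, ?_, ?_⟩, ?_⟩
  · intro c c' h
    obtain ⟨n1, n2⟩ := hG.row_ne h
    have := hr c c' 0 4 1 (by rw [h]; exact tilePos_east _)
    have a1 := CellKind.color_east _ _ _ _ (hrel c) n1
    have a2 := CellKind.color_west _ _ _ _ (hrel c') n2
    rw [hrot] at a1 a2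
    exact rowColor_injective (a1.symm.trans (this.trans a2))
  · intro c c' h h'
    have := hr c c' 3 5 3 (tilePos_south h h')
    have a1 := CellKind.color_south _ _ _ _ (hrel c)
    have a2 := CellKind.color_north _ _ _ _ (hrel c') (hG.column_ne h')
    rw [hrot] at a1 a2
    exact columnColor_injective (a1.symm.trans (this.trans a2))
  · funext v
    obtain ⟨⟨c, a⟩, rfl⟩ := hA.place_bijective.2 v
    rw [hA.rotations_place]
    exact congrFun (hrot c) a

/-- The number of solutions is the number of valid labelings. -/
theorem Realizes.numSolutions_eq (hG : Isolated G) (hA : Realizes A G) :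
    A.numSolutions = Nat.card {L : Cell G → Bool × Bool × Bool // Valid L} := by
  symm
  refine Nat.card_eq_of_bijective (fun L => ⟨hA.rotations L.1, L.2.isSolution hG hA⟩) ⟨?_, ?_⟩
  · rintro ⟨L, hL⟩ ⟨L', hL'⟩ h
    have h1 := congrArg Subtype.val h
    simp only at h1
    ext1
    funext c
    have h2 := CellKind.rotation_injective _ _ _ _ _ _ _ (hL.rel c) (hL'.rel c) (by
      funext a
      rw [← hA.rotations_place, ← hA.rotations_place, h1])
    exact Prod.ext h2.1 (Prod.ext h2.2.1 h2.2.2)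
  · rintro ⟨r, hr⟩
    obtain ⟨L, hL, rfl⟩ := hA.exists_valid hG hr
    exact ⟨⟨L, hL⟩, rfl⟩

end Diagram

/-! ### The diagram for a list of tokens -/

/-- The symbols of formulas in prefix notation. -/
inductive Token : Type
  | var (w : List Bool)
  | neg
  | conj
  | disj
  deriving DecidableEq

namespace Token

/-- The number of operands of a symbol. -/
def arity : Token → ℕ
  | var _ => 0
  | neg => 1
  | conj => 2
  | disj => 2

/-- Marks the first tokens of consecutive formulas by cells of given kinds, where `d` formulas are
skipped first. -/
def mark : List CellKind → ℕ → List Token → List CellKind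
  | _, _, [] => []
  -- The operands of the marked token must pass before the next formula starts.
  | m :: ms, 0, t :: ts => m :: mark ms t.arity ts
  | [], 0, t :: ts => .cross :: mark [] t.arity ts
  | ms, d + 1, t :: ts => .cross :: mark ms (d + t.arity) ts

/-- The kind of the first cell in the row of a token. -/
def diagonal : Token → CellKind
  -- The row of a conjunction carries the negated bit, since `!c = (a || !b)` is of the form that an
  -- `or` cell imposes.
  | conj => .neq
  | _ => .eq

/-- The kinds of the other cells in the row of a token. -/
def tail : Token → List Token → List CellKind
  | var w, ts => ts.map fun t => if t = var w then .eq else .cross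
  | neg, ts => mark [.neq] 0 ts
  | conj, ts => mark [.or, .neq] 0 ts
  | disj, ts => mark [.or, .eq] 0 ts

/-- The kinds of the cells in the row of the first of a list of tokens. -/
def row : List Token → List CellKind
  | [] => []
  | t :: ts => t.diagonal :: t.tail ts

/-- The diagram for a list of tokens. -/
def diagram (ts : List Token) : ℕ × ℕ → Option CellKind
  -- Cell `(i, k + 1)` belongs to the row of token `k` and the column of token `k + i`. Going down a
  -- column lowers `i` and raises the row number, so `(1, 0)` is right above `(0, 1)`, the only cell
  -- in the column of token 0.
  | (i, 0) => if i = 1 then some .one else none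
  | (i, k + 1) => (row (ts.drop k))[i]?

theorem length_mark (ms : List CellKind) (d : ℕ) (ts : List Token) :
    (mark ms d ts).length = ts.length := by
  induction ts generalizing ms d with
  | nil => cases ms <;> cases d <;> rfl
  | cons t ts ih => cases d <;> cases ms <;> simp [mark, ih]

theorem length_row (ts : List Token) : (row ts).length = ts.length := by
  cases ts with
  | nil => rfl
  | cons t ts => cases t <;> simp [row, tail, length_mark]

theorem one_notMem_mark {ms : List CellKind} (h : CellKind.one ∉ ms) (d : ℕ) (ts : List Token) :
    CellKind.one ∉ mark ms d ts := by
  induction ts generalizing ms d with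
  | nil => cases ms <;> cases d <;> simp [mark]
  | cons t ts ih =>
    cases d with
    | zero =>
      cases ms with
      | nil => simpa [mark] using ih h _
      | cons m ms =>
        simp only [List.mem_cons, not_or] at h
        simpa [mark, h.1] using ih h.2 _
    | succ d => cases ms <;> simpa [mark] using ih h _

theorem one_notMem_row (ts : List Token) : CellKind.one ∉ row ts := by
  cases ts with
  | nil => simp [row]
  | cons t ts =>
    cases t with
    | var w =>
      simp only [row, diagonal, tail, List.mem_cons, List.mem_map, not_or, not_exists, not_and]
      refine ⟨by decide, fun t _ => ?_⟩
      split_ifs <;> decide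
    | neg => simpa [row, diagonal, tail] using one_notMem_mark (by decide) _ _
    | conj => simpa [row, diagonal, tail] using one_notMem_mark (by decide) _ _
    | disj => simpa [row, diagonal, tail] using one_notMem_mark (by decide) _ _

theorem isolated_diagram (ts : List Token) : Diagram.Isolated (diagram ts) := by
  refine ⟨?_, rfl, rfl⟩
  rintro ⟨i, _ | k⟩ h
  · simp only [diagram] at h
    split_ifs at h with hi
    rw [hi]
  · exact absurd (List.mem_of_getElem? h) (one_notMem_row _)

/-! ### From labelings of cells to sequences of column bits. -/

/-- The bits `h` of the row fulfil the relations of the cells, for given bits of the columns. -/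
def RowRel (ks : List CellKind) (z h : ℕ → Bool) : Prop :=
  ∀ i (k : CellKind), ks[i]? = some k → k.Rel (z i) (h i) (h (i + 1))

/-- The bits of the columns determine the bits of the row. -/
def Rigid (ks : List CellKind) : Prop :=
  ∀ z h h', RowRel ks z h → RowRel ks z h' → ∀ i ≤ ks.length, h i = h' i

/-- The bits of the columns fulfil the relations of all rows. -/
def Good (ts : List Token) (z : ℕ → Bool) : Prop :=
  ∀ k < ts.length, ∃ h, RowRel (row (ts.drop k)) (fun i => z (k + i)) h

/-- Extends a finite sequence of bits. -/
def extend {n : ℕ} (z : Fin n → Bool) (i : ℕ) : Bool := if h : i < n then z ⟨i, h⟩ else false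

theorem diagram_isSome {ts : List Token} {i k : ℕ} (h : k + i < ts.length) :
    (diagram ts (i, k + 1)).isSome := by
  have h' : i < (row (ts.drop k)).length := by rw [length_row, List.length_drop]; omega
  rw [Option.isSome_iff_exists]
  exact ⟨_, List.getElem?_eq_getElem h'⟩

theorem lt_of_diagram {ts : List Token} {i k : ℕ} {q : CellKind}
    (h : diagram ts (i, k + 1) = some q) : k + i < ts.length := by
  have := (List.getElem?_eq_some_iff.1 h).1
  rw [length_row, List.length_drop] at this
  omega

open Diagram in
/-- The number of valid labelings is the number of the good bits of the columns. -/
theorem card_valid {ts : List Token} (h0 : ts ≠ [])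
    (hr : ∀ k < ts.length, Rigid (row (ts.drop k))) :
    Nat.card {L : Cell (diagram ts) → Bool × Bool × Bool // Valid L} =
      Nat.card {z : Fin ts.length → Bool // Good ts (extend z) ∧ extend z 0 = true} := by
  have hpos : 0 < ts.length := List.length_pos_iff.2 h0
  symm
  choose H hH using fun z : {z : Fin ts.length → Bool //
    Good ts (extend z) ∧ extend z 0 = true} => z.2.1
  let label (z : {z : Fin ts.length → Bool // Good ts (extend z) ∧ extend z 0 = true}) :
      Cell (diagram ts) → Bool × Bool × Bool
    | ⟨((_, 0), _), _⟩ => (true, true, true)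
    | ⟨((i, k + 1), _), hc⟩ =>
      have hk : k < ts.length := by have := lt_of_diagram hc; omega
      (extend z.1 (k + i), H z k hk i, H z k hk (i + 1))
  have hlabel : ∀ z, Valid (label z) := by
    intro z
    refine ⟨?_, ?_, ?_⟩
    · rintro ⟨⟨⟨i, _ | k⟩, q⟩, hc⟩
      · simp only [diagram] at hc
        split_ifs at hc
        cases hc
        simp [label, CellKind.Rel]
      · exact hH z k _ i q hc
    · rintro ⟨⟨⟨i, k⟩, q⟩, hc⟩ ⟨⟨⟨i', k'⟩, q'⟩, hc'⟩ h
      simp only [Prod.mk.injEq] at h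
      obtain ⟨rfl, rfl⟩ := h
      cases k' <;> rfl
    · rintro ⟨⟨⟨i, k⟩, q⟩, hc⟩ ⟨⟨⟨i', k'⟩, q'⟩, hc'⟩ h h'
      simp only at h h'
      subst h h'
      cases k with
      | zero =>
        simp only [diagram] at hc
        split_ifs at hc with hi
        obtain rfl : i' = 0 := by omega
        exact z.2.2.symm
      | succ k =>
        simp only [label]
        congr 1
        omega
  refine Nat.card_eq_of_bijective (fun z => ⟨label z, hlabel z⟩) ⟨?_, ?_⟩
  · intro z z' h
    have h1 := congrArg Subtype.val h
    simp only at h1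
    ext ⟨i, hi⟩
    obtain ⟨q, hq⟩ := Option.isSome_iff_exists.1 (diagram_isSome (ts := ts) (i := 0) (k := i) hi)
    have h2 := congrArg Prod.fst (congrFun h1 ⟨((0, i + 1), q), hq⟩)
    simpa [label, extend, hi] using h2
  · rintro ⟨L, hL⟩
    -- The labeling as a function of the coordinates alone; the value at absent cells is arbitrary.
    let total (i k : ℕ) : Bool × Bool × Bool :=
      if h : (diagram ts (i, k)).isSome then L ⟨((i, k), _), (Option.some_get h).symm⟩
      else (true, true, true)
    have htotal : ∀ c : Cell (diagram ts), L c = total c.1.1.1 c.1.1.2 := by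
      intro c
      have h : (diagram ts (c.1.1.1, c.1.1.2)).isSome := by
        have := c.2
        rw [Option.isSome_iff_exists]
        exact ⟨_, this⟩
      simp only [total, dif_pos h]
      congr 1
      exact cell_ext rfl
    -- Every column ends at the first cell of a row, from which its bit is read off.
    have hz : ∀ i k, k + i < ts.length → (total i (k + 1)).1 = (total 0 (k + i + 1)).1 := by
      intro i
      induction i with
      | zero => intro k _; rfl
      | succ i ih =>
        intro k hk
        obtain ⟨q, hq⟩ := Option.isSome_iff_exists.1 (diagram_isSome hk)
        obtain ⟨q', hq'⟩ := Option.isSome_iff_exists.1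
          (diagram_isSome (ts := ts) (i := i) (k := k + 1) (by omega))
        have h1 := hL.column ⟨((i + 1, k + 1), q), hq⟩ ⟨((i, k + 1 + 1), q'), hq'⟩ rfl rfl
        rw [htotal, htotal] at h1
        simp only at h1
        rw [h1, ih (k + 1) (by omega)]
        congr 2
        omega
    let z : Fin ts.length → Bool := fun i => (total 0 (i + 1)).1
    -- A row of `n` cells has `n + 1` bits: the west bit of the first cell, followed by the east
    -- bits of all cells.
    let h (k i : ℕ) : Bool := if i = 0 then (total 0 (k + 1)).2.1 else (total (i - 1) (k + 1)).2.2
    have hw : ∀ c : Cell (diagram ts), ∀ k, c.1.1.2 = k + 1 → (L c).2.1 = h k c.1.1.1 := by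
      rintro ⟨⟨⟨i, k'⟩, q⟩, hc⟩ k hk
      simp only at hk
      subst hk
      cases i with
      | zero => rw [htotal]; rfl
      | succ i =>
        have hi := lt_of_diagram hc
        obtain ⟨q', hq'⟩ := Option.isSome_iff_exists.1
          (diagram_isSome (ts := ts) (i := i) (k := k) (by omega))
        rw [← hL.row ⟨((i, k + 1), q'), hq'⟩ _ rfl, htotal]
        rfl
    have he : ∀ c : Cell (diagram ts), ∀ k, c.1.1.2 = k + 1 →
        (L c).2.2 = h k (c.1.1.1 + 1) := by
      rintro ⟨⟨⟨i, k'⟩, q⟩, hc⟩ k hk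
      simp only at hk
      subst hk
      rw [htotal]
      rfl
    have hzz : ∀ c : Cell (diagram ts), ∀ k, c.1.1.2 = k + 1 →
        (L c).1 = extend z (k + c.1.1.1) := by
      rintro ⟨⟨⟨i, k'⟩, q⟩, hc⟩ k hk
      simp only at hk
      subst hk
      have hi := lt_of_diagram hc
      rw [htotal]
      simp only [extend, dif_pos hi, z]
      exact hz i k hi
    have hrow : ∀ k < ts.length, RowRel (row (ts.drop k)) (fun i => extend z (k + i)) (h k) := by
      intro k _ i q hq
      have := hL.rel ⟨((i, k + 1), q), hq⟩
      rwa [hzz _ k rfl, hw _ k rfl, he _ k rfl] at this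
    have hone : extend z 0 = true := by
      obtain ⟨q, hq⟩ := Option.isSome_iff_exists.1
        (diagram_isSome (ts := ts) (i := 0) (k := 0) hpos)
      have h1 := hL.column ⟨((1, 0), .one), rfl⟩ ⟨((0, 1), q), hq⟩ rfl rfl
      have h2 := hL.rel ⟨((1, 0), .one), rfl⟩
      rw [hzz ⟨((0, 1), q), hq⟩ 0 rfl] at h1
      exact h1.symm.trans h2.1
    let Z : {z : Fin ts.length → Bool // Good ts (extend z) ∧ extend z 0 = true} :=
      ⟨z, fun k hk => ⟨h k, hrow k hk⟩, hone⟩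
    refine ⟨Z, ?_⟩
    ext1
    funext ⟨⟨⟨i, k⟩, q⟩, hc⟩
    cases k with
    | zero =>
      have h2 := hL.rel ⟨((i, 0), q), hc⟩
      simp only [diagram] at hc
      split_ifs at hc
      cases hc
      exact Prod.ext h2.1.symm (Prod.ext h2.2.1.symm h2.2.2.symm)
    | succ k =>
      have hi := lt_of_diagram hc
      have hk : k < ts.length := by omega
      -- Rigidity identifies the arbitrarily chosen row bits `H` with those of the given labeling.
      have heq := hr k hk _ _ _ (hH Z k hk) (hrow k hk)
      rw [length_row, List.length_drop] at heq
      refine Prod.ext ?_ (Prod.ext ?_ ?_)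
      · exact (hzz ⟨((i, k + 1), q), hc⟩ k rfl).symm
      · exact (heq i (by omega)).trans (hw ⟨((i, k + 1), q), hc⟩ k rfl).symm
      · exact (heq (i + 1) (by omega)).trans (he ⟨((i, k + 1), q), hc⟩ k rfl).symm

end Token

/-! ### The number of good bits for a formula -/

namespace Token

theorem rowRel_cons {k : CellKind} {ks : List CellKind} {z h : ℕ → Bool} :
    RowRel (k :: ks) z h ↔
      k.Rel (z 0) (h 0) (h 1) ∧ RowRel ks (fun i => z (i + 1)) (fun i => h (i + 1)) := by
  constructor
  · exact fun H => ⟨H 0 k rfl, fun i q hq => H (i + 1) q hq⟩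
  · rintro ⟨h0, H⟩ (_ | i) q hq
    · cases hq
      exact h0
    · exact H i q hq

/-- None of the cells changes the bit of the row. -/
def Flat (ks : List CellKind) : Prop := ∀ k ∈ ks, k ≠ .or ∧ k ≠ .one

theorem rel_of_flat {k : CellKind} (hk : k ≠ .or ∧ k ≠ .one) {z w e : Bool} :
    k.Rel z w e ↔ e = w ∧ k.Rel z w w := by
  revert z w e
  cases k <;> simp_all [CellKind.Rel]

/-- Each cell of a flat row has equal west and east bits, so the row carries a single bit. -/
theorem rowRel_flat {ks : List CellKind} (hks : Flat ks) {z h : ℕ → Bool} :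
    RowRel ks z h ↔ (∀ i ≤ ks.length, h i = h 0) ∧
      ∀ i (k : CellKind), ks[i]? = some k → k.Rel (z i) (h 0) (h 0) := by
  constructor
  · intro H
    have h1 : ∀ i ≤ ks.length, h i = h 0 := by
      intro i
      induction i with
      | zero => intro _; rfl
      | succ i ih =>
        intro hi
        have hi' : i < ks.length := hi
        have := H i _ (List.getElem?_eq_getElem hi')
        rw [← ih hi'.le]
        exact ((rel_of_flat (hks _ (List.getElem_mem hi'))).1 this).1
    refine ⟨h1, fun i k hk => ?_⟩
    have hi := (List.getElem?_eq_some_iff.1 hk).1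
    have := H i k hk
    rwa [h1 i hi.le, h1 (i + 1) hi] at this
  · rintro ⟨h1, h2⟩ i k hk
    have hi := (List.getElem?_eq_some_iff.1 hk).1
    rw [h1 i hi.le, h1 (i + 1) hi]
    exact h2 i k hk

/-- The cell prescribes the bit of the row as a function of the bit of the column. -/
def Prescribes (k : CellKind) (β : Bool → Bool) : Prop :=
  ∀ z w e, k.Rel z w e ↔ w = β z ∧ e = β z

theorem prescribes_eq : Prescribes .eq id := fun _ _ _ => Iff.rfl

theorem prescribes_neq : Prescribes .neq not := fun _ _ _ => Iff.rfl

theorem flat_replicate (n : ℕ) : Flat (List.replicate n .cross) := by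
  intro k hk
  rw [List.eq_of_mem_replicate hk]
  decide

/-- A row that is flat apart from its second cell. -/
theorem row_of_or {k q : CellKind} {β γ : Bool → Bool} (hk : Prescribes k β)
    (hq : Prescribes q γ) (hq' : q ≠ .or ∧ q ≠ .one) (m n : ℕ) :
    Rigid (k :: .or :: (List.replicate m .cross ++ q :: List.replicate n .cross)) ∧
    ∀ z, (∃ h, RowRel (k :: .or :: (List.replicate m .cross ++ q :: List.replicate n .cross)) z h) ↔
      β (z 0) = (z 1 || γ (z (m + 2))) := by
  have hflat : Flat (List.replicate m .cross ++ q :: List.replicate n .cross) := by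
    intro k hk
    simp only [List.mem_append, List.mem_cons] at hk
    rcases hk with hk | rfl | hk
    · exact flat_replicate _ k hk
    · exact hq'
    · exact flat_replicate _ k hk
  -- The row carries one bit up to the `or` cell and another one behind it. The first is prescribed
  -- by `k`, the second by `q`, and the `or` cell relates them.
  have key : ∀ z h, RowRel (k :: .or :: (List.replicate m .cross ++ q :: List.replicate n .cross))
      z h ↔ h 0 = β (z 0) ∧ h 1 = β (z 0) ∧ h 1 = (z 1 || h 2) ∧ h 2 = γ (z (m + 2)) ∧
        ∀ i ≤ m + n + 1, h (i + 2) = h 2 := by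
    intro z h
    rw [rowRel_cons, rowRel_cons, rowRel_flat hflat, hk, and_assoc]
    refine and_congr_right fun _ => and_congr_right fun _ => and_congr_right fun _ => ?_
    have hlen : (List.replicate m CellKind.cross ++ q :: List.replicate n .cross).length =
        m + n + 1 := by simp; omega
    rw [hlen, and_comm]
    refine and_congr_left fun _ => ?_
    constructor
    · intro H
      have := H m q (by simp)
      exact ((hq _ _ _).1 this).1
    · intro H i p hp
      rcases lt_trichotomy i m with hi | rfl | hi
      · rw [List.getElem?_append_left (by simpa using hi), List.getElem?_replicate, if_pos hi] at hp
        cases hp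
        rfl
      · rw [List.getElem?_append_right (by simp)] at hp
        simp at hp
        subst hp
        exact (hq _ _ _).2 ⟨H, H⟩
      · rw [List.getElem?_append_right (by simpa using hi.le)] at hp
        obtain ⟨j, rfl⟩ : ∃ j, i = m + 1 + j := ⟨i - (m + 1), by omega⟩
        have : m + 1 + j - (List.replicate m CellKind.cross).length = j + 1 := by simp; omega
        rw [this, List.getElem?_cons_succ, List.getElem?_replicate] at hp
        split_ifs at hp
        cases hp
        rfl
  constructor
  · intro z h h' H H' i hi
    rw [key] at H H'
    obtain ⟨a0, a1, a2, a3, a4⟩ := H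
    obtain ⟨b0, b1, b2, b3, b4⟩ := H'
    simp at hi
    rcases i with _ | _ | i
    · rw [a0, b0]
    · exact a1.trans b1.symm
    · rw [a4 i (by omega), b4 i (by omega), a3, b3]
  · intro z
    constructor
    · rintro ⟨h, H⟩
      rw [key] at H
      obtain ⟨a0, a1, a2, a3, a4⟩ := H
      rw [← a1, a2, a3]
    · intro H
      refine ⟨fun i => if i ≤ 1 then β (z 0) else γ (z (m + 2)), ?_⟩
      rw [key]
      refine ⟨rfl, rfl, H, rfl, fun i _ => ?_⟩
      simp

theorem row_of_flat {k : CellKind} {β : Bool → Bool} (hk : Prescribes k β)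
    {ks : List CellKind} (hks : Flat (k :: ks)) :
    Rigid (k :: ks) ∧
    ∀ z, (∃ h, RowRel (k :: ks) z h) ↔
      ∀ i (q : CellKind), ks[i]? = some q → q.Rel (z (i + 1)) (β (z 0)) (β (z 0)) := by
  constructor
  · intro z h h' H H' i hi
    rw [rowRel_flat hks] at H H'
    rw [H.1 i hi, H'.1 i hi, ((hk _ _ _).1 (H.2 0 k rfl)).1, ((hk _ _ _).1 (H'.2 0 k rfl)).1]
  · intro z
    constructor
    · rintro ⟨h, H⟩ i q hq
      rw [rowRel_flat hks] at H
      have := ((hk _ _ _).1 (H.2 0 k rfl)).1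
      rw [← this]
      exact H.2 (i + 1) q hq
    · intro H
      refine ⟨fun _ => β (z 0), (rowRel_flat hks).2 ⟨fun _ _ => rfl, ?_⟩⟩
      rintro (_ | i) q hq
      · cases hq
        exact (hk _ _ _).2 ⟨rfl, rfl⟩
      · exact H i q hq

theorem mark_succ (ms : List CellKind) (d : ℕ) (t : Token) (ts : List Token) :
    mark ms (d + 1) (t :: ts) = .cross :: mark ms (d + t.arity) ts := by
  cases ms <;> rfl

theorem mark_nil (d : ℕ) (ts : List Token) :
    mark [] d ts = List.replicate ts.length .cross := by
  induction ts generalizing d with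
  | nil => cases d <;> rfl
  | cons t ts ih => cases d <;> simp [mark, ih, List.replicate_succ]

theorem good_cons {t : Token} {ts : List Token} {z : ℕ → Bool} :
    Good (t :: ts) z ↔ (∃ h, RowRel (row (t :: ts)) z h) ∧ Good ts (fun i => z (i + 1)) := by
  constructor
  · intro H
    refine ⟨?_, fun k hk => ?_⟩
    · simpa using H 0 (by simp)
    · have := H (k + 1) (by simpa using hk)
      simpa [List.drop_succ_cons, Nat.add_right_comm] using this
  · rintro ⟨H0, H⟩ (_ | k) hk
    · simpa using H0
    · have := H k (by simpa using hk)
      simpa [List.drop_succ_cons, Nat.add_right_comm] using this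

/-- All rows are rigid. -/
def AllRigid (ts : List Token) : Prop := ∀ k < ts.length, Rigid (row (ts.drop k))

theorem allRigid_cons {t : Token} {ts : List Token} (h : Rigid (row (t :: ts)))
    (h' : AllRigid ts) : AllRigid (t :: ts) := by
  rintro (_ | k) hk
  · exact h
  · exact h' k (by simpa using hk)

end Token

/-! ### Twisted formulas and the values of their subformulas. -/

namespace BoolFormula

open Token

/-- Negates the first operands of conjunctions. -/
def twist : BoolFormula → BoolFormula
  | var w => var w
  | neg φ => neg φ.twist
  | conj φ ψ => conj (neg φ.twist) ψ.twist
  | disj φ ψ => disj φ.twist ψ.twist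

/-- The truth value of a formula where the first operand of a conjunction is read in negated
form. -/
def evalTwisted (a : List Bool → Bool) : BoolFormula → Bool
  | var w => a w
  | neg φ => !(φ.evalTwisted a)
  | conj φ ψ => !(φ.evalTwisted a) && ψ.evalTwisted a
  | disj φ ψ => φ.evalTwisted a || ψ.evalTwisted a

/-- The negation that `twist` inserts cancels the one with which the first operand of a conjunction
is read. -/
theorem evalTwisted_twist (a : List Bool → Bool) (φ : BoolFormula) :
    φ.twist.evalTwisted a = φ.eval a := by
  induction φ <;> simp_all [twist, evalTwisted, eval]

/-- The symbols of a formula in prefix notation. -/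
def tokens : BoolFormula → List Token
  | var w => [.var w]
  | neg φ => .neg :: φ.tokens
  | conj φ ψ => .conj :: (φ.tokens ++ ψ.tokens)
  | disj φ ψ => .disj :: (φ.tokens ++ ψ.tokens)

/-- The twisted truth values of all subformulas of a formula. -/
def values (a : List Bool → Bool) : BoolFormula → List Bool
  | var w => [a w]
  | neg φ => evalTwisted a (neg φ) :: φ.values a
  | conj φ ψ => evalTwisted a (conj φ ψ) :: (φ.values a ++ ψ.values a)
  | disj φ ψ => evalTwisted a (disj φ ψ) :: (φ.values a ++ ψ.values a)

theorem length_values (a : List Bool → Bool) (φ : BoolFormula) :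
    (φ.values a).length = φ.tokens.length := by
  induction φ <;> simp_all [values, tokens]

theorem values_ne_nil (a : List Bool → Bool) (φ : BoolFormula) :
    ∃ l, φ.values a = φ.evalTwisted a :: l := by
  cases φ <;> exact ⟨_, rfl⟩

theorem tokens_pos (φ : BoolFormula) : 0 < φ.tokens.length := by
  cases φ <;> simp [tokens]

theorem values_congr {a a' : List Bool → Bool} {φ : BoolFormula}
    (h : ∀ w, Token.var w ∈ φ.tokens → a w = a' w) :
    φ.values a = φ.values a' ∧ φ.evalTwisted a = φ.evalTwisted a' := by
  induction φ with
  | var w => simpa [values, evalTwisted] using h w (by simp [tokens])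
  | neg φ ih =>
    have := ih fun w hw => h w (by simp [tokens, hw])
    simp [values, evalTwisted, this]
  | conj φ ψ ih ih' =>
    have h1 := ih fun w hw => h w (by simp [tokens, hw])
    have h2 := ih' fun w hw => h w (by simp [tokens, hw])
    simp [values, evalTwisted, h1, h2]
  | disj φ ψ ih ih' =>
    have h1 := ih fun w hw => h w (by simp [tokens, hw])
    have h2 := ih' fun w hw => h w (by simp [tokens, hw])
    simp [values, evalTwisted, h1, h2]

theorem values_getElem? {a : List Bool → Bool} {φ : BoolFormula} {i : ℕ} {w : List Bool}
    (h : φ.tokens[i]? = some (.var w)) : (φ.values a)[i]? = some (a w) := by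
  induction φ generalizing i with
  | var v =>
    cases i <;> simp_all [tokens, values]
  | neg φ ih =>
    cases i with
    | zero => simp [tokens] at h
    | succ i => simpa [values] using ih (by simpa [tokens] using h)
  | conj φ ψ ih ih' | disj φ ψ ih ih' =>
    cases i with
    | zero => simp [tokens] at h
    | succ i =>
      simp only [tokens, List.getElem?_cons_succ] at h
      simp only [values, List.getElem?_cons_succ]
      rcases lt_or_ge i φ.tokens.length with hi | hi
      · rw [List.getElem?_append_left hi] at h
        rw [List.getElem?_append_left (by rwa [length_values])]
        exact ih h
      · rw [List.getElem?_append_right hi] at h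
        rw [List.getElem?_append_right (by rwa [length_values]), length_values]
        exact ih' h

theorem forest_values_getElem? {a : List Bool → Bool} {F : List BoolFormula} {i : ℕ}
    {w : List Bool} (h : (F.flatMap tokens)[i]? = some (.var w)) :
    (F.flatMap (values a))[i]? = some (a w) := by
  induction F generalizing i with
  | nil => simp at h
  | cons φ F ih =>
    rw [List.flatMap_cons] at h ⊢
    rcases lt_or_ge i φ.tokens.length with hi | hi
    · rw [List.getElem?_append_left hi] at h
      rw [List.getElem?_append_left (by rwa [length_values])]
      exact values_getElem? h
    · rw [List.getElem?_append_right hi] at h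
      rw [List.getElem?_append_right (by rwa [length_values]), length_values]
      exact ih h

/-- Every token takes one from the counter and adds its arity, so a complete formula lowers the
counter by exactly one. -/
theorem mark_tokens (ms : List CellKind) (d : ℕ) (φ : BoolFormula) (ts : List Token) :
    mark ms (d + 1) (φ.tokens ++ ts) =
      List.replicate φ.tokens.length .cross ++ mark ms d ts := by
  induction φ generalizing d ts with
  | var w => simp [tokens, mark_succ, arity]
  | neg φ ih => simp [tokens, mark_succ, arity, ih, List.replicate_succ]
  | conj φ ψ ih ih' | disj φ ψ ih ih' =>
    have : d + 2 = (d + 1) + 1 := rfl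
    simp only [tokens, List.cons_append, List.append_assoc, mark_succ, arity, this, ih, ih',
      List.length_cons, List.length_append, List.replicate_succ, List.replicate_add]

theorem mark_tokens_zero (m : CellKind) (ms : List CellKind) (φ : BoolFormula)
    (ts : List Token) :
    mark (m :: ms) 0 (φ.tokens ++ ts) =
      m :: (List.replicate (φ.tokens.length - 1) .cross ++ mark ms 0 ts) := by
  cases φ with
  | var w => simp [tokens, mark, arity]
  | neg φ => simp [tokens, mark, arity, mark_tokens]
  | conj φ ψ | disj φ ψ =>
    have : (2 : ℕ) = (0 + 1) + 1 := rfl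
    simp only [tokens, List.cons_append, List.append_assoc, mark, arity, this, mark_tokens,
      List.length_cons, List.length_append, List.replicate_add, Nat.add_sub_cancel]

/-- The sequence `z` starts with the list `l`. -/
def StartsWith (z : ℕ → Bool) (l : List Bool) : Prop := ∀ i b, l[i]? = some b → z i = b

theorem startsWith_cons {z : ℕ → Bool} {b : Bool} {l : List Bool} :
    StartsWith z (b :: l) ↔ z 0 = b ∧ StartsWith (fun i => z (i + 1)) l := by
  constructor
  · exact fun h => ⟨h 0 b rfl, fun i c hc => h (i + 1) c hc⟩
  · rintro ⟨h0, h⟩ (_ | i) c hc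
    · cases hc
      exact h0
    · exact h i c hc

theorem startsWith_eval {z : ℕ → Bool} {a : List Bool → Bool} {φ : BoolFormula} {l : List Bool}
    (h : StartsWith z (φ.values a ++ l)) : z 0 = φ.evalTwisted a := by
  obtain ⟨l', hl'⟩ := φ.values_ne_nil a
  rw [hl'] at h
  exact h 0 _ rfl

theorem startsWith_eval_snd {z : ℕ → Bool} {a : List Bool → Bool} {φ ψ : BoolFormula}
    {l : List Bool} (h : StartsWith z (φ.values a ++ (ψ.values a ++ l))) :
    z φ.tokens.length = ψ.evalTwisted a := by
  obtain ⟨l', hl'⟩ := ψ.values_ne_nil a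
  rw [hl'] at h
  refine h _ _ ?_
  rw [List.getElem?_append_right (by rw [length_values]), length_values]
  simp

/-- The good bits for a list of formulas are the values of the subformulas. -/
def Characterized (F : List BoolFormula) : Prop :=
  AllRigid (F.flatMap tokens) ∧
    ∀ z, Good (F.flatMap tokens) z ↔ ∃ a, StartsWith z (F.flatMap (values a))

/-- The row compares the bit to those of all later occurrences of `w`. If there are none, the bit is
free, and the assignment can be changed at `w` without affecting the values of `F`. -/
theorem characterized_var {F : List BoolFormula} (h : Characterized F) (w : List Bool) :
    Characterized (var w :: F) := by
  have e : (var w :: F).flatMap tokens = .var w :: F.flatMap tokens := rfl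
  have hflat : Flat (.eq :: (F.flatMap tokens).map
      fun t => if t = .var w then CellKind.eq else .cross) := by
    intro k hk
    simp only [List.mem_cons, List.mem_map] at hk
    rcases hk with rfl | ⟨t, -, rfl⟩
    · decide
    · split_ifs <;> decide
  obtain ⟨h1, h2⟩ := row_of_flat prescribes_eq hflat
  rw [Characterized, e]
  refine ⟨allRigid_cons h1 h.1, fun z => ?_⟩
  rw [good_cons, h.2]
  refine (and_congr_left' (h2 z)).trans ?_
  have e2 : ∀ a, (var w :: F).flatMap (values a) = a w :: F.flatMap (values a) := fun _ => rfl
  simp only [e2, startsWith_cons]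
  constructor
  · rintro ⟨H, a, ha⟩
    have H' : ∀ i, (F.flatMap tokens)[i]? = some (.var w) → z (i + 1) = z 0 := by
      intro i hi
      have := H i .eq (by simp [hi])
      exact this.1.symm
    by_cases hw : Token.var w ∈ F.flatMap tokens
    · obtain ⟨i, hi⟩ := List.mem_iff_getElem?.1 hw
      refine ⟨a, ?_, ha⟩
      rw [← H' i hi]
      exact ha i _ (forest_values_getElem? hi)
    · refine ⟨Function.update a w (z 0), by simp, ?_⟩
      have : F.flatMap (values (Function.update a w (z 0))) = F.flatMap (values a) := by
        refine List.flatMap_congr fun φ hφ => (values_congr fun v hv => ?_).1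
        refine Function.update_of_ne ?_ _ _
        rintro rfl
        exact hw (List.mem_flatMap.2 ⟨φ, hφ, hv⟩)
      rwa [this]
  · rintro ⟨a, h0, ha⟩
    refine ⟨fun i q hq => ?_, a, ha⟩
    rw [List.getElem?_map, Option.map_eq_some_iff] at hq
    obtain ⟨t, ht, rfl⟩ := hq
    split_ifs with htw
    · subst htw
      have := ha i _ (forest_values_getElem? ht)
      simp only at this
      simp [CellKind.Rel, this, h0]
    · rfl

theorem characterized_neg {F : List BoolFormula} {φ : BoolFormula}
    (h : Characterized (φ :: F)) : Characterized (neg φ :: F) := by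
  have e : (neg φ :: F).flatMap tokens = .neg :: (φ :: F).flatMap tokens := rfl
  have e3 : row (.neg :: (φ :: F).flatMap tokens) = .eq :: .neq ::
      (List.replicate (φ.tokens.length - 1) .cross ++
        List.replicate (F.flatMap tokens).length .cross) := by
    simp only [row, Token.tail, diagonal, List.flatMap_cons, mark_tokens_zero, mark_nil]
  rw [← List.replicate_add] at e3
  have hflat : Flat (.eq :: .neq ::
      List.replicate (φ.tokens.length - 1 + (F.flatMap tokens).length) .cross) := by
    intro k hk
    simp only [List.mem_cons] at hk
    rcases hk with rfl | rfl | hk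
    · decide
    · decide
    · exact flat_replicate _ k hk
  obtain ⟨h1, h2⟩ := row_of_flat prescribes_eq hflat
  rw [Characterized, e]
  refine ⟨allRigid_cons (by rwa [e3]) h.1, fun z => ?_⟩
  rw [good_cons, h.2, e3]
  refine (and_congr_left' (h2 z)).trans ?_
  have e2 : ∀ a, (neg φ :: F).flatMap (values a) =
      evalTwisted a (neg φ) :: (φ :: F).flatMap (values a) := fun _ => rfl
  simp only [e2, startsWith_cons]
  constructor
  · rintro ⟨H, a, ha⟩
    refine ⟨a, ?_, ha⟩
    have h3 := (H 0 .neq rfl).1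
    have h4 := startsWith_eval ha
    simp only [Nat.zero_add, id] at h3 h4
    rw [h3, h4]
    rfl
  · rintro ⟨a, h0, ha⟩
    refine ⟨?_, a, ha⟩
    rintro (_ | i) q hq
    · cases hq
      have h4 := startsWith_eval ha
      simp only [Nat.zero_add] at h4
      simp [CellKind.Rel, h0, h4, evalTwisted]
    · rw [List.getElem?_cons_succ, List.getElem?_replicate] at hq
      split_ifs at hq
      cases hq
      rfl

/-- The step for a binary connective. -/
theorem characterized_binary {F : List BoolFormula} {φ ψ χ : BoolFormula} {t : Token}
    {q : CellKind} {β : Bool → Bool} (h : Characterized (φ :: ψ :: F))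
    (hχ : χ.tokens = t :: (φ.tokens ++ ψ.tokens))
    (hχ' : ∀ a, χ.values a = χ.evalTwisted a :: (φ.values a ++ ψ.values a))
    (hd : t.diagonal = q) (ht : ∀ ts, t.tail ts = mark [.or, q] 0 ts) (hq : Prescribes q β)
    (hq' : q ≠ .or ∧ q ≠ .one)
    (hβ : ∀ a b, b = χ.evalTwisted a ↔ β b = (φ.evalTwisted a || β (ψ.evalTwisted a))) :
    Characterized (χ :: F) := by
  have e : (χ :: F).flatMap tokens = t :: (φ :: ψ :: F).flatMap tokens := by
    simp [hχ]
  have hφ := φ.tokens_pos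
  have e3 : row (t :: (φ :: ψ :: F).flatMap tokens) = q :: .or ::
      (List.replicate (φ.tokens.length - 1) .cross ++ q ::
        List.replicate (ψ.tokens.length - 1 + (F.flatMap tokens).length) .cross) := by
    simp only [row, ht, hd, List.flatMap_cons, mark_tokens_zero, mark_nil, List.replicate_add]
  obtain ⟨h1, h2⟩ := row_of_or hq hq hq' (φ.tokens.length - 1)
    (ψ.tokens.length - 1 + (F.flatMap tokens).length)
  rw [Characterized, e]
  refine ⟨allRigid_cons (by rwa [e3]) h.1, fun z => ?_⟩
  rw [good_cons, h.2, e3]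
  refine (and_congr_left' (h2 z)).trans ?_
  have e2 : ∀ a, (χ :: F).flatMap (values a) =
      χ.evalTwisted a :: (φ :: ψ :: F).flatMap (values a) := by
    intro a
    simp [hχ']
  -- The column of the second operand comes after the connective and all tokens of the first
  -- operand.
  have e4 : φ.tokens.length - 1 + 2 = φ.tokens.length + 1 := by omega
  simp only [e2, startsWith_cons, e4]
  have key : ∀ a, StartsWith (fun i => z (i + 1)) ((φ :: ψ :: F).flatMap (values a)) →
      (z 0 = χ.evalTwisted a ↔ β (z 0) = (z 1 || β (z (φ.tokens.length + 1)))) := by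
    intro a ha
    rw [hβ, ← startsWith_eval ha, ← startsWith_eval_snd ha]
  constructor
  · rintro ⟨H, a, ha⟩
    exact ⟨a, (key a ha).2 H, ha⟩
  · rintro ⟨a, h0, ha⟩
    exact ⟨(key a ha).1 h0, a, ha⟩

theorem characterized_cons {F : List BoolFormula} (h : Characterized F) (φ : BoolFormula) :
    Characterized (φ :: F) := by
  induction φ generalizing F with
  | var w => exact characterized_var h w
  | neg φ ih => exact characterized_neg (ih h)
  | conj φ ψ ih ih' =>
    -- With `β = not` the row says `!b = (x || !y)`, that is, `b = (!x && y)`.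
    refine characterized_binary (ih (ih' h)) rfl (fun _ => rfl) rfl (fun _ => rfl) prescribes_neq
      (by decide) fun a b => ?_
    simp only [evalTwisted]
    cases b <;> cases evalTwisted a φ <;> cases evalTwisted a ψ <;> decide
  | disj φ ψ ih ih' =>
    refine characterized_binary (ih (ih' h)) rfl (fun _ => rfl) rfl (fun _ => rfl) prescribes_eq
      (by decide) fun a b => ?_
    simp only [evalTwisted, id]

theorem characterized_nil : Characterized [] :=
  ⟨fun _ h => absurd h (by simp), fun _ =>
    ⟨fun _ => ⟨fun _ => false, fun _ _ h => by simp at h⟩, fun _ _ h => absurd h (by simp)⟩⟩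

theorem var_mem_tokens_twist {φ : BoolFormula} {w : List Bool} :
    Token.var w ∈ φ.twist.tokens ↔ w ∈ φ.vars := by
  induction φ <;> simp_all [twist, tokens, vars]

/-- The number of good bits that start with `true` is the number of satisfying assignments. -/
theorem card_good (φ : BoolFormula) :
    Nat.card {z : Fin φ.twist.tokens.length → Bool //
      Good φ.twist.tokens (extend z) ∧ extend z 0 = true} = φ.numSat := by
  have hpos := φ.twist.tokens_pos
  obtain ⟨-, hgood⟩ := characterized_cons characterized_nil φ.twist
  simp only [List.flatMap_cons, List.flatMap_nil, List.append_nil] at hgood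
  let ext (a : {w // w ∈ φ.vars} → Bool) (w : List Bool) : Bool :=
    if h : w ∈ φ.vars then a ⟨w, h⟩ else false
  let bits (a : {w // w ∈ φ.vars} → Bool) (i : Fin φ.twist.tokens.length) : Bool :=
    (φ.twist.values (ext a))[i.1]'(by rw [length_values]; exact i.2)
  have hbits : ∀ a, StartsWith (extend (bits a)) (φ.twist.values (ext a)) := by
    intro a i b hb
    obtain ⟨hi, rfl⟩ := List.getElem?_eq_some_iff.1 hb
    rw [length_values] at hi
    simp [extend, hi, bits]
  have hzero : ∀ a, extend (bits a) 0 = φ.eval (ext a) := by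
    intro a
    rw [← evalTwisted_twist]
    exact startsWith_eval (l := []) (by simpa using hbits a)
  symm
  refine Nat.card_eq_of_bijective
    (fun a => ⟨bits a.1, (hgood _).2 ⟨_, hbits a.1⟩, (hzero a.1).trans a.2⟩) ⟨?_, ?_⟩
  · rintro ⟨a, ha⟩ ⟨a', ha'⟩ h
    have h1 : bits a = bits a' := congrArg Subtype.val h
    ext1
    funext ⟨w, hw⟩
    -- Every variable occurs as a token, and the bit of that column is its value.
    obtain ⟨i, hi⟩ := List.mem_iff_getElem?.1 (var_mem_tokens_twist.2 hw)
    have h2 := hbits a i _ (values_getElem? hi)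
    have h3 := hbits a' i _ (values_getElem? hi)
    rw [h1, h3] at h2
    simpa [ext, hw] using h2.symm
  · rintro ⟨z, hz, hz0⟩
    obtain ⟨a, ha⟩ := (hgood _).1 hz
    -- The assignment `a` is defined on all names, but only its restriction to the variables of `φ`
    -- influences the values.
    have hv : φ.twist.values (ext fun w => a w.1) = φ.twist.values a := by
      refine (values_congr fun w hw => ?_).1
      simp [ext, var_mem_tokens_twist.1 hw]
    have hb : bits (fun w => a w.1) = z := by
      funext i
      have h1 := hbits (fun w => a w.1) i _
        (List.getElem?_eq_getElem (by rw [length_values]; exact i.2))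
      have h2 := ha i ((φ.twist.values (ext fun w => a w.1))[i.1]'(by
        rw [length_values]; exact i.2)) (by rw [← hv]; exact List.getElem?_eq_getElem _)
      have h3 := h1.trans h2.symm
      simpa [extend] using h3
    refine ⟨⟨fun w => a w.1, ?_⟩, Subtype.ext hb⟩
    have := hzero fun w => a w.1
    rw [hb, hz0] at this
    exact this.symm

end BoolFormula

/-! ### The list of the placed tiles -/

namespace Token

/-- The code of a symbol, as in `BoolFormula.encode`. -/
def code : Token → List Bool
  | var w => false :: false :: BoolFormula.encodeName w
  | neg => [false, true]
  | conj => [true, false]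
  | disj => [true, true]

theorem two_le_length_code (t : Token) : 2 ≤ t.code.length := by cases t <;> simp [code]

theorem length_le_length_flatMap_code (ts : List Token) :
    2 * ts.length ≤ (ts.flatMap code).length := by
  induction ts with
  | nil => simp
  | cons t ts ih =>
    have := two_le_length_code t
    simp only [List.flatMap_cons, List.length_append, List.length_cons]
    omega

end Token

theorem BoolFormula.flatMap_code_tokens (φ : BoolFormula) :
    φ.tokens.flatMap Token.code = φ.encode := by
  induction φ <;> simp_all [tokens, encode, Token.code]

theorem encodePuzzle_append (l l' : List ((ℤ × ℤ) × TantrixTile)) :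
    encodePuzzle (l ++ l') = encodePuzzle l ++ encodePuzzle l' := by
  induction l with
  | nil => rfl
  | cons e l ih => simp [encodePuzzle, ih]

namespace CellKind

/-- The tiles of a cell at a given place, with their positions. -/
def entries (k : CellKind) (c : ℕ × ℕ) (l : List (Fin 6)) : List ((ℤ × ℤ) × TantrixTile) :=
  l.map fun a => (tilePos c a, k.tile a)

/-- The tiles of the cells of a row, from a given place on, with their positions. -/
def rowEntries : List CellKind → ℕ → ℕ → List ((ℤ × ℤ) × TantrixTile)
  | [], _, _ => []
  -- Later cells come first: the program pushes its output on a stack, so what is written first ends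
  -- up last.
  | k :: ks, X, Y => rowEntries ks (X + 1) Y ++ k.entries (X, Y) (List.finRange 6)

theorem mem_rowEntries {ks : List CellKind} {X Y : ℕ} {e : (ℤ × ℤ) × TantrixTile} :
    e ∈ rowEntries ks X Y ↔
      ∃ i k a, ks[i]? = some k ∧ e = (tilePos (X + i, Y) a, k.tile a) := by
  induction ks generalizing X with
  | nil => simp [rowEntries]
  | cons k ks ih =>
    simp only [rowEntries, List.mem_append, ih, entries, List.mem_map, List.mem_finRange, true_and]
    constructor
    · rintro (⟨i, q, a, h, rfl⟩ | ⟨a, rfl⟩)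
      · exact ⟨i + 1, q, a, h, by rw [Nat.add_right_comm, Nat.add_assoc]⟩
      · exact ⟨0, k, a, rfl, rfl⟩
    · rintro ⟨_ | i, q, a, h, rfl⟩
      · cases h
        exact Or.inr ⟨a, rfl⟩
      · exact Or.inl ⟨i, q, a, h, by rw [Nat.add_right_comm, Nat.add_assoc]⟩

theorem nodup_rowEntries (ks : List CellKind) (X Y : ℕ) :
    ((rowEntries ks X Y).map Prod.fst).Nodup := by
  induction ks generalizing X with
  | nil => simp [rowEntries]
  | cons k ks ih =>
    rw [rowEntries, List.map_append, List.nodup_append]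
    refine ⟨ih _, ?_, ?_⟩
    · rw [entries, List.map_map]
      exact (List.nodup_finRange 6).map fun a b h => (tilePos_injective h).2
    · simp only [List.mem_map, mem_rowEntries, entries]
      rintro _ ⟨_, ⟨i, q, a, h, rfl⟩, rfl⟩ _ ⟨_, ⟨b, _, rfl⟩, rfl⟩ he
      have := congrArg Prod.fst (tilePos_injective he).1
      simp only at this
      omega

end CellKind

namespace Token

/-- The tiles of the rows of the diagram for a list of tokens, where the first row has a given
number. -/
def rowsEntries : List Token → ℕ → List ((ℤ × ℤ) × TantrixTile)
  | [], _ => []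
  | t :: ts, Y => rowsEntries ts (Y + 1) ++ CellKind.rowEntries (row (t :: ts)) 0 Y

/-- The tiles of the diagram for a list of tokens, with their positions. -/
def layout (ts : List Token) : List ((ℤ × ℤ) × TantrixTile) :=
  rowsEntries ts 1 ++ CellKind.one.entries (1, 0) (List.finRange 6)

theorem mem_rowsEntries {ts : List Token} {Y : ℕ} {e : (ℤ × ℤ) × TantrixTile} :
    e ∈ rowsEntries ts Y ↔ ∃ j i k a, (row (ts.drop j))[i]? = some k ∧
      e = (tilePos (i, Y + j) a, k.tile a) := by
  induction ts generalizing Y with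
  | nil => simp [rowsEntries, row]
  | cons t ts ih =>
    simp only [rowsEntries, List.mem_append, ih, CellKind.mem_rowEntries, Nat.zero_add]
    constructor
    · rintro (⟨j, i, k, a, h, rfl⟩ | ⟨i, k, a, h, rfl⟩)
      · exact ⟨j + 1, i, k, a, h, by rw [Nat.add_right_comm, Nat.add_assoc]⟩
      · exact ⟨0, i, k, a, h, rfl⟩
    · rintro ⟨_ | j, i, k, a, h, rfl⟩
      · exact Or.inr ⟨i, k, a, h, rfl⟩
      · exact Or.inl ⟨j, i, k, a, h, by rw [Nat.add_right_comm, Nat.add_assoc]⟩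

theorem mem_layout {ts : List Token} {e : (ℤ × ℤ) × TantrixTile} :
    e ∈ layout ts ↔ ∃ c k a, diagram ts c = some k ∧ e = (tilePos c a, k.tile a) := by
  simp only [layout, List.mem_append, mem_rowsEntries, CellKind.entries, List.mem_map,
    List.mem_finRange, true_and]
  constructor
  · rintro (⟨j, i, k, a, h, rfl⟩ | ⟨a, rfl⟩)
    · exact ⟨(i, j + 1), k, a, h, by rw [Nat.add_comm]⟩
    · exact ⟨(1, 0), .one, a, rfl, rfl⟩
  · rintro ⟨⟨i, _ | j⟩, k, a, h, rfl⟩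
    · simp only [diagram] at h
      split_ifs at h with hi
      cases h
      exact Or.inr ⟨a, by rw [hi]⟩
    · exact Or.inl ⟨j, i, k, a, h, by rw [Nat.add_comm]⟩

theorem nodup_rowsEntries (ts : List Token) (Y : ℕ) :
    ((rowsEntries ts Y).map Prod.fst).Nodup := by
  induction ts generalizing Y with
  | nil => simp [rowsEntries]
  | cons t ts ih =>
    rw [rowsEntries, List.map_append, List.nodup_append]
    refine ⟨ih _, CellKind.nodup_rowEntries _ _ _, ?_⟩
    simp only [List.mem_map, CellKind.mem_rowEntries, mem_rowsEntries]
    rintro _ ⟨_, ⟨j, i, q, a, h, rfl⟩, rfl⟩ _ ⟨_, ⟨i', q', b, _, rfl⟩, rfl⟩ he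
    have := congrArg Prod.snd (tilePos_injective he).1
    simp only at this
    omega

theorem nodup_layout (ts : List Token) : ((layout ts).map Prod.fst).Nodup := by
  rw [layout, List.map_append, List.nodup_append]
  refine ⟨nodup_rowsEntries _ _, ?_, ?_⟩
  · rw [CellKind.entries, List.map_map]
    exact (List.nodup_finRange 6).map fun a b h => (tilePos_injective h).2
  · simp only [List.mem_map, mem_rowsEntries, CellKind.entries]
    rintro _ ⟨_, ⟨j, i, q, a, h, rfl⟩, rfl⟩ _ ⟨_, ⟨b, _, rfl⟩, rfl⟩ he
    have := congrArg Prod.snd (tilePos_injective he).1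
    simp only at this
    omega

end Token

/-! ### Correctness of the reduction. -/

theorem List.lookup_eq_some_iff_mem {α β : Type*} [BEq α] [LawfulBEq α] {l : List (α × β)}
    (h : (l.map Prod.fst).Nodup) {v : α} {t : β} : l.lookup v = some t ↔ (v, t) ∈ l := by
  induction l with
  | nil => simp
  | cons e l ih =>
    obtain ⟨u, s⟩ := e
    rw [List.map_cons, List.nodup_cons] at h
    by_cases hv : v = u
    · subst hv
      simp only [List.lookup_cons_self, Option.some.injEq, List.mem_cons, Prod.mk.injEq, true_and]
      constructor
      · exact fun h => Or.inl h.symm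
      · rintro (rfl | h')
        · rfl
        · exact absurd (List.mem_map_of_mem (f := Prod.fst) h') h.1
    · have : (v == u) = false := by simpa using hv
      simp [List.lookup_cons, this, ih h.2, hv]

theorem Token.realizes_layout (ts : List Token) :
    Diagram.Realizes (TRPInstance.ofList (layout ts)) (diagram ts) := by
  intro v t
  rw [show (TRPInstance.ofList (layout ts)).tile v = (layout ts).lookup v from rfl,
    List.lookup_eq_some_iff_mem (nodup_layout ts), mem_layout]
  simp only [Prod.mk.injEq]

open Classical in
/-- The reduction from `#SAT` to `#TRP`. -/
noncomputable def tantrixReduction (x : List Bool) : List Bool :=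
  if h : ∃ φ : BoolFormula, φ.encode = x then encodePuzzle (Token.layout h.choose.twist.tokens)
  else [true]

theorem tantrixReduction_encode (φ : BoolFormula) :
    tantrixReduction φ.encode = encodePuzzle (Token.layout φ.twist.tokens) := by
  have h : ∃ ψ : BoolFormula, ψ.encode = φ.encode := ⟨φ, rfl⟩
  rw [tantrixReduction, dif_pos h, BoolFormula.encode_injective h.choose_spec]

/-- A sign bit without a numeral starts no entry. The empty string could not replace `[true]` as the
value at strings that encode no formula: it encodes the empty puzzle, which has one solution. -/
theorem encodePuzzle_ne_singleton (l : List ((ℤ × ℤ) × TantrixTile)) :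
    encodePuzzle l ≠ [true] := by
  rcases l with _ | ⟨⟨⟨i, j⟩, t⟩, l⟩
  · simp [encodePuzzle]
  · cases i <;> simp [encodePuzzle, encodeEntry, encodeInt, encodeUnary]

theorem BoolFormula.numSolutions_layout (φ : BoolFormula) :
    (TRPInstance.ofList (Token.layout φ.twist.tokens)).numSolutions = φ.numSat := by
  rw [(Token.realizes_layout _).numSolutions_eq (Token.isolated_diagram _), Token.card_valid,
    card_good]
  · exact List.ne_nil_of_length_pos (tokens_pos _)
  · have := (characterized_cons characterized_nil φ.twist).1
    rwa [List.flatMap_singleton] at this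

theorem sharpSAT_eq_sharpTRP (x : List Bool) : sharpSAT x = sharpTRP (tantrixReduction x) := by
  by_cases h : ∃ φ : BoolFormula, φ.encode = x
  · obtain ⟨φ, rfl⟩ := h
    rw [tantrixReduction_encode, sharpSAT, sharpTRP,
      Function.partialInv_left BoolFormula.encode_injective,
      Function.partialInv_left encodePuzzle_injective]
    simp only [if_pos (Token.nodup_layout φ.twist.tokens), BoolFormula.numSolutions_layout]
  · have h₁ : Function.partialInv BoolFormula.encode x = none := by
      simp only [Function.partialInv]
      rw [dif_neg h]
    have h₂ : Function.partialInv encodePuzzle [true] = none := by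
      simp only [Function.partialInv]
      exact dif_neg fun ⟨l, hl⟩ => encodePuzzle_ne_singleton l hl
    rw [tantrixReduction, dif_neg h, sharpSAT, sharpTRP, h₁, h₂]

/-! ### Programs that write the tiles -/

/-- Numbers in unary. -/
abbrev ones (n : ℕ) : List Bool := List.replicate n true

namespace Prog

/-- Empties a stack. -/
def clear (k : StackName) : Prog := loop k true skip skip skip

/-- Moves the contents of a stack to another stack, in reversed order. -/
def move (k k' : StackName) : Prog := loop k true skip (push k' false) (push k' true)

/-- Pushes a list on a stack. -/
def pushList (k : StackName) : List Bool → Prog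
  | [] => skip
  | v :: l => seq (pushList k l) (push k v)

/-- Pushes `m` ones on the stack `o` for every element of the stack `k`. -/
def scale (k : StackName) (m : ℕ) : Prog :=
  seq (loop k true skip skip (seq (push .t true) (pushList .o (ones m))))
    (loop .t true skip skip (push k true))

/-- Writes the entry for a tile at a given place of the cell whose coordinates are on the stacks
`x` and `y`. -/
def emitTile (t : TantrixTile) (i j : ℕ) : Prog :=
  -- The entry is written from its end. The `false` before the tile ends the second coordinate. Of
  -- the two in the next line, the first ends the first coordinate and the second is the sign of the
  -- second coordinate.
  seq (pushList .o (false :: t.encode)) (seq (scale .x 2)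
    (seq (pushList .o (false :: false :: ones j)) (seq (scale .x 3) (seq (scale .y 5)
      (pushList .o (false :: ones i))))))

/-- Writes the entries for some tiles of a cell. -/
def emitTiles (k : CellKind) : List (Fin 6) → Prog
  | [] => skip
  | a :: l => seq (emitTiles k l) (emitTile (k.tile a) (boxX a) (boxY a))

/-- Writes the entries for the tiles of a cell and goes on to the next column. -/
def emitCell (k : CellKind) : Prog := seq (emitTiles k (List.finRange 6)) (push .x true)

/-! ### Effect and running time of the programs that write tiles. -/

theorem reach_clear (k : StackName) (S : Store) :
    (clear k).Reach S (S.set k []) (2 * (S.get k).length + 2) := by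
  generalize h : S.get k = l
  induction l generalizing S with
  | nil =>
    have : S.set k [] = S := Store.set_get_nil h
    rw [this]
    exact .loop_nil h .skip
  | cons v l ih =>
    have h₁ : (S.set k l).get k = l := by cases k <;> rfl
    have h₂ : (S.set k l).set k [] = S.set k [] := by cases k <;> rfl
    have ih' := ih (S.set k l) h₁
    rw [h₂] at ih'
    cases v with
    | false => exact (Reach.loop_false h .skip ih').mono (by simp; omega)
    | true => exact (Reach.loop_true h .skip ih').mono (by simp; omega)

theorem reach_move {k k' : StackName} (hk : k ≠ k') (S : Store) :
    (move k k').Reach S ((S.set k []).set k' ((S.get k).reverse ++ S.get k'))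
      (2 * (S.get k).length + 2) := by
  generalize h : S.get k = l
  induction l generalizing S with
  | nil =>
    have : (S.set k []).set k' (S.get k') = S := by
      rw [Store.set_get_nil h]
      cases k' <;> rfl
    rw [List.reverse_nil, List.nil_append, this]
    exact .loop_nil h .skip
  | cons v l ih =>
    have h₁ (u) : ((S.set k l).set k' u).get k = l := by
      cases k <;> cases k' <;> first | rfl | exact absurd rfl hk
    have h₂ (u w) : (((S.set k l).set k' u).set k []).set k' w = (S.set k []).set k' w := by
      cases k <;> cases k' <;> rfl
    have h₃ (u) : ((S.set k l).set k' u).get k' = u := by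
      cases k' <;> rfl
    have h₄ : (S.set k l).get k' = S.get k' := by
      cases k <;> cases k' <;> first | rfl | exact absurd rfl hk
    have ih' := ih ((S.set k l).set k' (v :: S.get k')) (h₁ _)
    rw [h₂, h₃] at ih'
    rw [List.reverse_cons, List.append_assoc]
    have hp : (push k' v).Reach (S.set k l) ((S.set k l).set k' (v :: S.get k')) 1 := by
      rw [← h₄]
      exact .push
    cases v with
    | false => exact (Reach.loop_false h hp ih').mono (by simp; omega)
    | true => exact (Reach.loop_true h hp ih').mono (by simp; omega)

theorem reach_pushList (k : StackName) (l : List Bool) (S : Store) :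
    (pushList k l).Reach S (S.set k (l ++ S.get k)) (l.length + 1) := by
  induction l with
  | nil =>
    have : S.set k (S.get k) = S := by cases k <;> rfl
    rw [List.nil_append, this]
    exact .skip
  | cons v l ih =>
    have h : S.set k (v :: l ++ S.get k) = (S.set k (l ++ S.get k)).set k
        (v :: (S.set k (l ++ S.get k)).get k) := by cases k <;> rfl
    rw [h]
    exact ih.seq .push

/-- The first loop empties the stack into `t` at `m + 3` steps for each element, the second restores
it at 2 steps for each. -/
theorem reach_scale_x (m n : ℕ) (a b d e f y o : List Bool) :
    (scale .x m).Reach ⟨a, b, d, e, f, ones n, y, [], o⟩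
      ⟨a, b, d, e, f, ones n, y, [], ones (m * n) ++ o⟩ ((m + 5) * n + 4) := by
  have h₁ (n j : ℕ) (o : List Bool) :
      (loop .x true skip skip (seq (push .t true) (pushList .o (ones m)))).Reach
        ⟨a, b, d, e, f, ones n, y, ones j, o⟩
        ⟨a, b, d, e, f, [], y, ones (n + j), ones (m * n) ++ o⟩ ((m + 3) * n + 2) := by
    induction n generalizing j o with
    | zero => exact .loop_nil rfl (by simpa using .skip)
    | succ n ih =>
      have ih' := ih (j + 1) (ones m ++ o)
      rw [← List.append_assoc, List.replicate_append_replicate, ← Nat.mul_succ, ← Nat.add_assoc,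
        Nat.add_right_comm] at ih'
      refine Reach.mono (.loop_true rfl (.seq .push (reach_pushList _ _ _)) ih') ?_
      simp
      ring_nf
      omega
  have h₂ (n i : ℕ) (o : List Bool) : (loop .t true skip skip (push .x true)).Reach
        ⟨a, b, d, e, f, ones i, y, ones n, o⟩
        ⟨a, b, d, e, f, ones (n + i), y, [], o⟩ (2 * n + 2) := by
    induction n generalizing i with
    | zero => exact .loop_nil rfl (by simpa using .skip)
    | succ n ih =>
      have ih' := ih (i + 1)
      rw [← Nat.add_assoc, Nat.add_right_comm] at ih'
      exact Reach.mono (.loop_true rfl .push ih') (by omega)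
  refine Reach.mono (.seq (h₁ n 0 o) (h₂ n 0 _)) ?_
  ring_nf
  omega

theorem reach_scale_y (m n : ℕ) (a b d e f x o : List Bool) :
    (scale .y m).Reach ⟨a, b, d, e, f, x, ones n, [], o⟩
      ⟨a, b, d, e, f, x, ones n, [], ones (m * n) ++ o⟩ ((m + 5) * n + 4) := by
  have h₁ (n j : ℕ) (o : List Bool) :
      (loop .y true skip skip (seq (push .t true) (pushList .o (ones m)))).Reach
        ⟨a, b, d, e, f, x, ones n, ones j, o⟩
        ⟨a, b, d, e, f, x, [], ones (n + j), ones (m * n) ++ o⟩ ((m + 3) * n + 2) := by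
    induction n generalizing j o with
    | zero => exact .loop_nil rfl (by simpa using .skip)
    | succ n ih =>
      have ih' := ih (j + 1) (ones m ++ o)
      rw [← List.append_assoc, List.replicate_append_replicate, ← Nat.mul_succ, ← Nat.add_assoc,
        Nat.add_right_comm] at ih'
      refine Reach.mono (.loop_true rfl (.seq .push (reach_pushList _ _ _)) ih') ?_
      simp
      ring_nf
      omega
  have h₂ (n i : ℕ) (o : List Bool) : (loop .t true skip skip (push .y true)).Reach
        ⟨a, b, d, e, f, x, ones i, ones n, o⟩
        ⟨a, b, d, e, f, x, ones (n + i), [], o⟩ (2 * n + 2) := by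
    induction n generalizing i with
    | zero => exact .loop_nil rfl (by simpa using .skip)
    | succ n ih =>
      have ih' := ih (i + 1)
      rw [← Nat.add_assoc, Nat.add_right_comm] at ih'
      exact Reach.mono (.loop_true rfl .push ih') (by omega)
  refine Reach.mono (.seq (h₁ n 0 o) (h₂ n 0 _)) ?_
  ring_nf
  omega

theorem length_encode_tile (t : TantrixTile) : t.encode.length = 8 := by
  have hk (k : TileKind) : k.encode.length = 2 := by cases k <;> rfl
  have hc (c : TantrixColor) : c.encode.length = 2 := by cases c <;> rfl
  simp [TantrixTile.encode, hk, hc]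

theorem encodeInt_natCast (n : ℕ) : encodeInt n = false :: (ones n ++ [false]) := rfl

theorem reach_emitTile (t : TantrixTile) (c : Fin 6) (X Y : ℕ) (a b d e f o : List Bool) :
    (emitTile t (boxX c) (boxY c)).Reach ⟨a, b, d, e, f, ones X, ones Y, [], o⟩
      ⟨a, b, d, e, f, ones X, ones Y, [], encodeEntry (tilePos (X, Y) c, t) ++ o⟩
      (40 * (X + Y + 1)) := by
  have h : encodeEntry (tilePos (X, Y) c, t) ++ o = false :: ones (boxX c) ++ (ones (5 * Y) ++
      (ones (3 * X) ++ (false :: false :: ones (boxY c) ++ (ones (2 * X) ++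
        (false :: t.encode ++ o))))) := by
    have h₁ : tilePos (X, Y) c =
        (((boxX c + (5 * Y + 3 * X) : ℕ) : ℤ), ((boxY c + 2 * X : ℕ) : ℤ)) := by
      simp only [tilePos, Prod.mk.injEq]
      constructor <;> push_cast <;> ring
    rw [encodeEntry, h₁]
    simp only [encodeInt_natCast]
    simp [ones, List.replicate_add, -List.replicate_append_replicate]
  have h₁ := boxX_le c
  have h₂ := boxY_le c
  rw [h]
  refine Reach.mono (.seq (reach_pushList _ _ _) (.seq (reach_scale_x _ _ _ _ _ _ _ _ _)
    (.seq (reach_pushList _ _ _) (.seq (reach_scale_x _ _ _ _ _ _ _ _ _)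
    (.seq (reach_scale_y _ _ _ _ _ _ _ _ _) (reach_pushList _ _ _)))))) ?_
  simp [length_encode_tile]
  omega

theorem reach_emitTiles (k : CellKind) (l : List (Fin 6)) (X Y : ℕ) (a b d e f o : List Bool) :
    (emitTiles k l).Reach ⟨a, b, d, e, f, ones X, ones Y, [], o⟩
      ⟨a, b, d, e, f, ones X, ones Y, [], encodePuzzle (k.entries (X, Y) l) ++ o⟩
      (40 * (X + Y + 1) * l.length + 1) := by
  induction l with
  | nil => exact .skip
  | cons c l ih =>
    have h : encodePuzzle (k.entries (X, Y) (c :: l)) ++ o =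
        encodeEntry (tilePos (X, Y) c, k.tile c) ++ (encodePuzzle (k.entries (X, Y) l) ++ o) := by
      simp [CellKind.entries, encodePuzzle]
    rw [h]
    refine Reach.mono (.seq ih (reach_emitTile _ _ _ _ _ _ _ _ _ _)) ?_
    rw [List.length_cons, Nat.mul_succ (40 * (X + Y + 1))]
    omega

/-- Six tiles at `40 * (2 * N + 1)` steps each, and 2 further steps. -/
theorem reach_emitCell (k : CellKind) {X Y N : ℕ} (hX : X ≤ N) (hY : Y ≤ N)
    (a b d e f o : List Bool) :
    (emitCell k).Reach ⟨a, b, d, e, f, ones X, ones Y, [], o⟩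
      ⟨a, b, d, e, f, ones (X + 1), ones Y, [],
        encodePuzzle (k.entries (X, Y) (List.finRange 6)) ++ o⟩ (500 * (N + 1)) := by
  refine Reach.mono (.seq (reach_emitTiles _ _ _ _ _ _ _ _ _ _) .push) ?_
  rw [List.length_finRange]
  omega

end Prog

/-! ### Programs that write the rows of the diagram -/

namespace Prog

open BoolFormula (encodeName)

/-- Moves a bit from the stack `a` to the stack `b`. -/
def moveBit : Prog := pop .a skip (push .b false) (push .b true)

/-- Moves the code of a name from the stack `a` to the stack `b`. -/
def moveName : Prog := loop .a false skip (push .b false) (seq (push .b true) moveBit)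

/-- Writes a cell of a row as in `Token.mark`, where the stack `d` holds the number of formulas to
be skipped, and the stack `f` the number of marks that are left. The last mark is `k₁` and the one
before is `k₂`. -/
def emitMark (k₁ k₂ : CellKind) : Prog :=
  pop .d
    (pop .f (emitCell .cross) skip
      (pop .f (emitCell k₁) skip (seq (push .f true) (emitCell k₂))))
    skip (emitCell .cross)

/-- Moves the tokens from the stack `a` to the stack `b` and writes a row as in `Token.mark`. -/
def scanMarks (k₁ k₂ : CellKind) : Prog :=
  loop .a true skip
    (seq (push .b false) (seq (emitMark k₁ k₂)
      (pop .a skip (seq (push .b false) moveName) (seq (push .b true) (push .d true)))))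
    (seq (push .b true) (seq (emitMark k₁ k₂) (seq moveBit (pushList .d (ones 2)))))

/-- Compares a bit of a name on the stack `a` to a bit of the name on the stack `d`. -/
def compareBit : Prog :=
  pop .a skip
    (seq (push .b false)
      (pop .d (push .e true) (push .f false) (seq (push .f true) (push .e true))))
    (seq (push .b true)
      (pop .d (push .e true) (seq (push .f false) (push .e true)) (push .f true)))

/-- Compares a name on the stack `a` to the prefix of the same length of the name on the stack `d`,
moves both, and pushes bits on the stack `e` if they differ. -/
def comparePrefix : Prog := loop .a false skip (push .b false) (seq (push .b true) compareBit)

/-- Compares a name on the stack `a` to the name on the stack `d`, and pushes bits on the stack `e`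
if they differ. -/
def compareName : Prog :=
  seq comparePrefix
    (seq (pop .d skip (seq (push .d false) (push .e true)) (seq (push .d true) (push .e true)))
      (move .f .d))

/-- Moves the tokens from the stack `a` to the stack `b` and writes the row of the variable whose
name is on the stack `d`. -/
def scanNames : Prog :=
  loop .a true skip
    (seq (push .b false) (pop .a skip
      (seq (push .b false) (seq compareName
        (pop .e (emitCell .eq) skip (seq (clear .e) (emitCell .cross)))))
      (seq (push .b true) (emitCell .cross))))
    (seq (push .b true) (seq moveBit (emitCell .cross)))

/-- Moves a name from the stack `a` to the stack `d`. -/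
def readName : Prog :=
  seq (loop .a false skip skip (pop .a skip (push .f false) (push .f true))) (move .f .d)

/-- Restores the stacks and goes on to the next row. -/
def nextRow : Prog :=
  seq (move .b .a) (seq (clear .d) (seq (clear .f) (seq (clear .x) (push .y true))))

/-- Writes the rows for the tokens on the stack `a`. -/
def emitRows : Prog :=
  loop .a true (clear .y)
    (pop .a skip
      (seq readName (seq (emitCell .eq) (seq scanNames nextRow)))
      -- A negation has a single mark, so the second kind given to `scanMarks` is never chosen as a
      -- mark.
      (seq (push .f true) (seq (emitCell .eq) (seq (scanMarks .neq .cross) nextRow))))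
    (pop .a skip
      (seq (pushList .f (ones 2)) (seq (emitCell .neq) (seq (scanMarks .neq .or) nextRow)))
      (seq (pushList .f (ones 2)) (seq (emitCell .eq) (seq (scanMarks .eq .or) nextRow))))

/-! ### Effect and running time of the programs that write rows. -/

theorem reach_moveBit (v : Bool) (a b d e f x y t o : List Bool) :
    moveBit.Reach ⟨v :: a, b, d, e, f, x, y, t, o⟩ ⟨a, v :: b, d, e, f, x, y, t, o⟩ 2 := by
  cases v with
  | false => exact .pop_false rfl .push
  | true => exact .pop_true rfl .push

theorem reach_moveName (w a b d e f x y t o : List Bool) :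
    moveName.Reach ⟨encodeName w ++ a, b, d, e, f, x, y, t, o⟩
      ⟨a, (encodeName w).reverse ++ b, d, e, f, x, y, t, o⟩ (4 * (encodeName w).length) := by
  induction w generalizing b with
  | nil => exact Reach.mono (.loop_exit rfl .push) (by simp [encodeName])
  | cons v w ih =>
    have ih' := ih (v :: true :: b)
    have h : (encodeName (v :: w)).reverse ++ b = (encodeName w).reverse ++ v :: true :: b := by
      simp [encodeName]
    rw [h]
    refine Reach.mono (.loop_true rfl (.seq .push (reach_moveBit _ _ _ _ _ _ _ _ _ _)) ih') ?_
    simp only [encodeName, List.length_cons]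
    omega

/-- The marks that are left. -/
def marks (k₁ k₂ : CellKind) : ℕ → List CellKind
  | 0 => []
  | 1 => [k₁]
  | _ => [k₂, k₁]

/-- The kind of the cell does not depend on the token `t`, so the cell can be written after the
first bit of the token's code; its arity is added to the counter afterwards. -/
theorem reach_emitMark (k₁ k₂ : CellKind) {D n X Y N : ℕ} (hn : n ≤ 2) (hX : X ≤ N) (hY : Y ≤ N) :
    ∃ D' n' k, D' ≤ D ∧ n' ≤ 2 ∧
      (∀ t ts, Token.mark (marks k₁ k₂ n) D (t :: ts) =
        k :: Token.mark (marks k₁ k₂ n') (D' + t.arity) ts) ∧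
      ∀ a b e o, (emitMark k₁ k₂).Reach ⟨a, b, ones D, e, ones n, ones X, ones Y, [], o⟩
        ⟨a, b, ones D', e, ones n', ones (X + 1), ones Y, [],
          encodePuzzle (k.entries (X, Y) (List.finRange 6)) ++ o⟩ (500 * (N + 1) + 5) := by
  have h (k : CellKind) (a b d e f o : List Bool) := reach_emitCell k hX hY a b d e f o
  rcases D with _ | D
  · rcases n with _ | _ | _ | n
    · refine ⟨0, 0, .cross, le_rfl, hn, fun t ts => ?_, fun a b e o => ?_⟩
      · simp [marks, Token.mark]
      · exact Reach.mono (.pop_nil rfl (.pop_nil rfl (h _ _ _ _ _ _ _))) (by omega)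
    · refine ⟨0, 0, k₁, le_rfl, by omega, fun t ts => ?_, fun a b e o => ?_⟩
      · simp [marks, Token.mark]
      · exact Reach.mono (.pop_nil rfl (.pop_true rfl (.pop_nil rfl (h _ _ _ _ _ _ _))))
          (by omega)
    · refine ⟨0, 1, k₂, le_rfl, by omega, fun t ts => ?_, fun a b e o => ?_⟩
      · simp [marks, Token.mark]
      · exact Reach.mono (.pop_nil rfl (.pop_true rfl (.pop_true rfl
          (.seq .push (h _ _ _ _ _ _ _))))) (by omega)
    · omega
  · refine ⟨D, n, .cross, by omega, hn, fun t ts => Token.mark_succ _ _ _ _, fun a b e o => ?_⟩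
    exact Reach.mono (.pop_true rfl (h _ _ _ _ _ _ _)) (by omega)

/-- Every bit of the codes is charged with `T` steps. A code has at least two bits, which pays for
its cell and for moving its name. -/
theorem reach_scanMarks (k₁ k₂ : CellKind) {D n X Y N T : ℕ} (ts : List Token) (hn : n ≤ 2)
    (hT : 1000 * (N + 1) ≤ T) (hX : X + ts.length ≤ N) (hY : Y ≤ N) (b e o : List Bool) :
    ∃ D' n', D' ≤ D + 2 * ts.length ∧ n' ≤ 2 ∧
      (scanMarks k₁ k₂).Reach
        ⟨ts.flatMap Token.code, b, ones D, e, ones n, ones X, ones Y, [], o⟩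
        ⟨[], (ts.flatMap Token.code).reverse ++ b, ones D', e, ones n', ones (X + ts.length),
          ones Y, [], encodePuzzle (CellKind.rowEntries
            (Token.mark (marks k₁ k₂ n) D ts) X Y) ++ o⟩
        (T * (ts.flatMap Token.code).length + 2) := by
  induction ts generalizing D n X b o with
  | nil =>
    refine ⟨D, n, by omega, hn, .loop_nil rfl ?_⟩
    have : Token.mark (marks k₁ k₂ n) D [] = [] := by cases marks k₁ k₂ n <;> cases D <;> rfl
    simpa [this, CellKind.rowEntries, encodePuzzle] using .skip
  | cons t ts ih =>
    rw [List.length_cons] at hX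
    obtain ⟨D₁, n₁, k, hD₁, hn₁, hm, hr⟩ := reach_emitMark k₁ k₂ (D := D) hn
      (show X ≤ N by omega) hY
    obtain ⟨D₂, n₂, hD₂, hn₂, ih'⟩ := ih (D := D₁ + t.arity) (X := X + 1) hn₁ (by omega)
      (t.code.reverse ++ b) (encodePuzzle (k.entries (X, Y) (List.finRange 6)) ++ o)
    refine ⟨D₂, n₂, ?_, hn₂, ?_⟩
    · have : t.arity ≤ 2 := by cases t <;> simp [Token.arity]
      simp only [List.length_cons]
      omega
    have hx : X + (t :: ts).length = X + 1 + ts.length := by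
      rw [List.length_cons]
      omega
    rw [hm, CellKind.rowEntries, encodePuzzle_append, List.flatMap_cons, List.reverse_append,
      List.append_assoc, List.append_assoc, hx, List.length_append, Nat.mul_add]
    have hT' (m : ℕ) : 4 * m ≤ T * m := Nat.mul_le_mul_right m (by omega)
    cases t with
    | var w =>
      have hb : (Token.code (.var w)).reverse ++ b =
          (encodeName w).reverse ++ false :: false :: b := by simp [Token.code]
      rw [hb] at ih' ⊢
      refine Reach.mono (.loop_false rfl (.seq .push (.seq (hr _ _ _ _) (.pop_false rfl
        (.seq .push (reach_moveName _ _ _ _ _ _ _ _ _ _))))) ih') ?_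
      have := hT' (encodeName w).length
      simp only [Token.code, List.length_cons, Nat.mul_add]
      omega
    | neg =>
      refine Reach.mono (.loop_false rfl (.seq .push (.seq (hr _ _ _ _) (.pop_true rfl
        (.seq .push .push)))) ih') ?_
      simp only [Token.code, List.length_cons, List.length_nil]
      omega
    | conj =>
      refine Reach.mono (.loop_true rfl (.seq .push (.seq (hr _ _ _ _)
        (.seq (reach_moveBit _ _ _ _ _ _ _ _ _ _) (reach_pushList _ _ _)))) ih') ?_
      simp only [Token.code, List.length_cons, List.length_nil, List.length_replicate]
      omega
    | disj =>
      refine Reach.mono (.loop_true rfl (.seq .push (.seq (hr _ _ _ _)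
        (.seq (reach_moveBit _ _ _ _ _ _ _ _ _ _) (reach_pushList _ _ _)))) ih') ?_
      simp only [Token.code, List.length_cons, List.length_nil, List.length_replicate]
      omega

theorem length_encodeName (w : List Bool) : (encodeName w).length = 2 * w.length + 1 := by
  induction w with
  | nil => rfl
  | cons v w ih =>
    simp only [encodeName, List.length_cons, ih]
    omega

/-- The stack `e` gains a bit at each mismatch and never loses one, so it ends empty only if it was
empty and all bits agreed. The consumed part of `u` is kept reversed on `f`, to be restored later.
-/
theorem reach_comparePrefix (v u a b f x y t o : List Bool) (i : ℕ) :
    ∃ j, (j = 0 ↔ i = 0 ∧ v <+: u) ∧ j ≤ i + v.length ∧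
      comparePrefix.Reach ⟨encodeName v ++ a, b, u, ones i, f, x, y, t, o⟩
        ⟨a, (encodeName v).reverse ++ b, u.drop v.length, ones j,
          (u.take v.length).reverse ++ f, x, y, t, o⟩ (10 * v.length + 2) := by
  induction v generalizing u b f i with
  | nil => exact ⟨i, by simp, by simp, .loop_exit rfl .push⟩
  | cons c v ih =>
    have hb : (encodeName (c :: v)).reverse ++ b = (encodeName v).reverse ++ c :: true :: b := by
      simp [encodeName]
    rw [hb]
    rcases u with _ | ⟨w, u⟩
    · obtain ⟨j, hj, hj', ih'⟩ := ih [] (c :: true :: b) f (i + 1)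
      refine ⟨j, by simpa using hj, by rw [List.length_cons]; omega, ?_⟩
      rw [List.drop_nil, List.take_nil] at ih' ⊢
      cases c with
      | false =>
        exact Reach.mono (.loop_true rfl (.seq .push (.pop_false rfl (.seq .push
          (.pop_nil rfl .push)))) ih') (by rw [List.length_cons]; omega)
      | true =>
        exact Reach.mono (.loop_true rfl (.seq .push (.pop_true rfl (.seq .push
          (.pop_nil rfl .push)))) ih') (by rw [List.length_cons]; omega)
    · have hf : ((w :: u).take (c :: v).length).reverse ++ f =
          (u.take v.length).reverse ++ w :: f := by simp
      rw [hf, List.length_cons, List.drop_succ_cons, List.cons_prefix_cons]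
      by_cases hw : c = w
      · obtain ⟨j, hj, hj', ih'⟩ := ih u (c :: true :: b) (w :: f) i
        refine ⟨j, by simpa [hw] using hj, by omega, ?_⟩
        subst hw
        cases c with
        | false =>
          exact Reach.mono (.loop_true rfl (.seq .push (.pop_false rfl (.seq .push
            (.pop_false rfl .push)))) ih') (by omega)
        | true =>
          exact Reach.mono (.loop_true rfl (.seq .push (.pop_true rfl (.seq .push
            (.pop_true rfl .push)))) ih') (by omega)
      · obtain ⟨j, hj, hj', ih'⟩ := ih u (c :: true :: b) (w :: f) (i + 1)
        refine ⟨j, by simpa [hw] using hj, by omega, ?_⟩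
        cases c with
        | false =>
          obtain rfl : w = true := by simpa using hw
          exact Reach.mono (.loop_true rfl (.seq .push (.pop_false rfl (.seq .push
            (.pop_true rfl (.seq .push .push))))) ih') (by omega)
        | true =>
          obtain rfl : w = false := by simpa using hw
          exact Reach.mono (.loop_true rfl (.seq .push (.pop_true rfl (.seq .push
            (.pop_false rfl (.seq .push .push))))) ih') (by omega)

/-- A prefix of `u` equals `u` if nothing of `u` is left on `d`, which is what the additional `pop`
tests. -/
theorem reach_compareName (v u a b x y t o : List Bool) :
    ∃ j, (j = 0 ↔ v = u) ∧ j ≤ v.length + 1 ∧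
      compareName.Reach ⟨encodeName v ++ a, b, u, [], [], x, y, t, o⟩
        ⟨a, (encodeName v).reverse ++ b, u, ones j, [], x, y, t, o⟩ (12 * v.length + 20) := by
  obtain ⟨j, hj, hj', h₁⟩ := reach_comparePrefix v u a b [] x y t o 0
  obtain ⟨j', hj₁, hj₂, h₂⟩ : ∃ j', (j' = 0 ↔ v = u) ∧ j' ≤ j + 1 ∧
      (pop .d skip (seq (push .d false) (push .e true)) (seq (push .d true) (push .e true))).Reach
        ⟨a, (encodeName v).reverse ++ b, u.drop v.length, ones j,
          (u.take v.length).reverse ++ [], x, y, t, o⟩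
        ⟨a, (encodeName v).reverse ++ b, u.drop v.length, ones j',
          (u.take v.length).reverse ++ [], x, y, t, o⟩ 3 := by
    rcases h : u.drop v.length with _ | ⟨w, l⟩
    · refine ⟨j, ?_, by omega, Reach.mono (.pop_nil rfl .skip) (by omega)⟩
      rw [hj]
      constructor
      · exact fun h' => h'.2.eq_of_length_le (List.drop_eq_nil_iff.1 h)
      · rintro rfl
        exact ⟨rfl, List.prefix_refl _⟩
    · refine ⟨j + 1, ?_, le_rfl, ?_⟩
      · simp only [Nat.add_eq_zero_iff, one_ne_zero, and_false, false_iff]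
        rintro rfl
        simp at h
      · cases w with
        | false => exact .pop_false rfl (.seq .push .push)
        | true => exact .pop_true rfl (.seq .push .push)
  have h₃ := reach_move (k := .f) (k' := .d) (by decide)
    ⟨a, (encodeName v).reverse ++ b, u.drop v.length, ones j', (u.take v.length).reverse ++ [],
      x, y, t, o⟩
  simp only [Store.set, Store.get, List.append_nil, List.reverse_reverse, List.take_append_drop,
    List.length_reverse] at h₁ h₂ h₃
  have := List.length_take_le v.length u
  exact ⟨j', hj₁, by omega, Reach.mono (.seq h₁ (.seq h₂ h₃)) (by omega)⟩

theorem reach_scanNames {X Y N T : ℕ} (ts : List Token) (hT : 1000 * (N + 1) ≤ T)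
    (hX : X + ts.length ≤ N) (hY : Y ≤ N) (u b o : List Bool) :
    scanNames.Reach ⟨ts.flatMap Token.code, b, u, [], [], ones X, ones Y, [], o⟩
      ⟨[], (ts.flatMap Token.code).reverse ++ b, u, [], [], ones (X + ts.length), ones Y, [],
        encodePuzzle (CellKind.rowEntries
          (ts.map fun t => if t = .var u then .eq else .cross) X Y) ++ o⟩
      (T * (ts.flatMap Token.code).length + 2) := by
  induction ts generalizing X b o with
  | nil => exact .loop_nil rfl .skip
  | cons t ts ih =>
    rw [List.length_cons] at hX
    have hr (k : CellKind) (a b d e f o : List Bool) :=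
      reach_emitCell k (show X ≤ N by omega) hY a b d e f o
    have ih' := ih (X := X + 1) (by omega) (t.code.reverse ++ b)
      (encodePuzzle (CellKind.entries (if t = .var u then .eq else .cross) (X, Y)
        (List.finRange 6)) ++ o)
    have hx : X + (t :: ts).length = X + 1 + ts.length := by
      rw [List.length_cons]
      omega
    rw [List.map_cons, CellKind.rowEntries, encodePuzzle_append, List.flatMap_cons,
      List.reverse_append, List.append_assoc, List.append_assoc, hx, List.length_append,
      Nat.mul_add]
    cases t with
    | var w =>
      have hb : (Token.code (.var w)).reverse ++ b =
          (encodeName w).reverse ++ false :: false :: b := by simp [Token.code]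
      have hT' : 1000 * w.length ≤ T * w.length := Nat.mul_le_mul_right _ (by omega)
      have hT'' : T * (Token.code (.var w)).length = 2 * (T * w.length) + 3 * T := by
        rw [Token.code, List.length_cons, List.length_cons, length_encodeName]
        ring
      rw [hb] at ih' ⊢
      rw [hT'']
      obtain ⟨j, hj, hj', hc⟩ := reach_compareName w u (ts.flatMap Token.code)
        (false :: false :: b) (ones X) (ones Y) [] o
      by_cases hw : w = u
      · obtain rfl := hj.2 hw
        rw [if_pos (by rw [hw])] at ih' ⊢
        refine Reach.mono (.loop_false rfl (.seq .push (.pop_false rfl (.seq .push (.seq hc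
          (.pop_nil rfl (hr _ _ _ _ _ _ _)))))) ih') ?_
        omega
      · rw [if_neg (by simpa using hw)] at ih' ⊢
        obtain ⟨j, rfl⟩ := Nat.exists_eq_succ_of_ne_zero (fun h => hw (hj.1 h))
        refine Reach.mono (.loop_false rfl (.seq .push (.pop_false rfl (.seq .push (.seq hc
          (.pop_true rfl (.seq (reach_clear _ _) (hr _ _ _ _ _ _ _))))))) ih') ?_
        simp only [Store.get, Store.set, List.length_replicate]
        omega
    | neg =>
      refine Reach.mono (.loop_false rfl (.seq .push (.pop_true rfl
        (.seq .push (hr _ _ _ _ _ _ _)))) ih') ?_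
      simp only [Token.code, List.length_cons, List.length_nil]
      omega
    | conj =>
      refine Reach.mono (.loop_true rfl (.seq .push
        (.seq (reach_moveBit _ _ _ _ _ _ _ _ _ _) (hr _ _ _ _ _ _ _))) ih') ?_
      simp only [Token.code, List.length_cons, List.length_nil]
      omega
    | disj =>
      refine Reach.mono (.loop_true rfl (.seq .push
        (.seq (reach_moveBit _ _ _ _ _ _ _ _ _ _) (hr _ _ _ _ _ _ _))) ih') ?_
      simp only [Token.code, List.length_cons, List.length_nil]
      omega

theorem reach_readName (w a b e x y t o : List Bool) :
    readName.Reach ⟨encodeName w ++ a, b, [], e, [], x, y, t, o⟩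
      ⟨a, b, w, e, [], x, y, t, o⟩ (6 * w.length + 4) := by
  have h₁ (f : List Bool) :
      (loop .a false skip skip (pop .a skip (push .f false) (push .f true))).Reach
        ⟨encodeName w ++ a, b, [], e, f, x, y, t, o⟩
        ⟨a, b, [], e, w.reverse ++ f, x, y, t, o⟩ (4 * w.length + 2) := by
    induction w generalizing f with
    | nil => exact .loop_exit rfl .skip
    | cons v w ih =>
      have ih' := ih (v :: f)
      rw [List.reverse_cons, List.append_assoc]
      cases v with
      | false =>
        exact Reach.mono (.loop_true rfl (.pop_false rfl .push) ih')
          (by rw [List.length_cons]; omega)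
      | true =>
        exact Reach.mono (.loop_true rfl (.pop_true rfl .push) ih')
          (by rw [List.length_cons]; omega)
  have h₂ := reach_move (k := .f) (k' := .d) (by decide)
    ⟨a, b, [], e, w.reverse ++ [], x, y, t, o⟩
  simp only [Store.set, Store.get, List.append_nil, List.reverse_reverse,
    List.length_reverse] at h₂
  have h₁' := h₁ []
  rw [List.append_nil] at h₁'
  exact Reach.mono (.seq h₁' h₂) (by omega)

theorem reach_nextRow (b d f x o : List Bool) (Y : ℕ) :
    nextRow.Reach ⟨[], b.reverse ++ [], d, [], f, x, ones Y, [], o⟩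
      ⟨b, [], [], [], [], [], ones (Y + 1), [], o⟩
      (2 * b.length + 2 * d.length + 2 * f.length + 2 * x.length + 9) := by
  have h := reach_move (k := .b) (k' := .a) (by decide)
    ⟨[], b.reverse ++ [], d, [], f, x, ones Y, [], o⟩
  simp only [Store.set, Store.get, List.append_nil, List.reverse_reverse,
    List.length_reverse] at h ⊢
  refine Reach.mono (.seq h (.seq (reach_clear _ _) (.seq (reach_clear _ _)
    (.seq (reach_clear _ _) .push)))) ?_
  simp only [Store.set, Store.get]
  omega

theorem reach_marksRow (k k₁ k₂ : CellKind) {n Y N T : ℕ} (ts : List Token) (hn : n ≤ 2)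
    (hT : 1000 * (N + 1) ≤ T) (hX : ts.length + 1 ≤ N) (hY : Y ≤ N) (o : List Bool) :
    (seq (emitCell k) (seq (scanMarks k₁ k₂) nextRow)).Reach
      ⟨ts.flatMap Token.code, [], [], [], ones n, [], ones Y, [], o⟩
      ⟨ts.flatMap Token.code, [], [], [], [], [], ones (Y + 1), [],
        encodePuzzle (CellKind.rowEntries (k :: Token.mark (marks k₁ k₂ n) 0 ts) 0 Y) ++ o⟩
      (T * (2 * (ts.flatMap Token.code).length + 1)) := by
  obtain ⟨D, n', hD, hn', h⟩ := reach_scanMarks k₁ k₂ (D := 0) (X := 0 + 1) ts hn hT (by omega) hY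
    [] [] (encodePuzzle (k.entries (0, Y) (List.finRange 6)) ++ o)
  rw [CellKind.rowEntries, encodePuzzle_append, List.append_assoc]
  have h₀ := reach_emitCell k (X := 0) (Nat.zero_le N) hY (ts.flatMap Token.code) [] [] []
    (ones n) o
  refine Reach.mono (.seq h₀ (.seq h (reach_nextRow _ _ _ _ _ _))) ?_
  simp only [List.length_replicate]
  have h₁ := Token.length_le_length_flatMap_code ts
  have h₂ : 1000 * (ts.flatMap Token.code).length ≤ T * (ts.flatMap Token.code).length :=
    Nat.mul_le_mul_right _ (by omega)
  rw [Nat.mul_add T, Nat.mul_left_comm T]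
  omega

theorem reach_namesRow (w : List Bool) {Y N T : ℕ} (ts : List Token)
    (hT : 1000 * (N + 1) ≤ T) (hX : ts.length + 1 ≤ N) (hY : Y ≤ N) (o : List Bool) :
    (seq readName (seq (emitCell .eq) (seq scanNames nextRow))).Reach
      ⟨encodeName w ++ ts.flatMap Token.code, [], [], [], [], [], ones Y, [], o⟩
      ⟨ts.flatMap Token.code, [], [], [], [], [], ones (Y + 1), [],
        encodePuzzle (CellKind.rowEntries (Token.row (.var w :: ts)) 0 Y) ++ o⟩
      (T * (2 * (ts.flatMap Token.code).length + w.length + 1)) := by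
  have h := reach_scanNames (X := 0 + 1) ts hT (by omega) hY w []
    (encodePuzzle (CellKind.eq.entries (0, Y) (List.finRange 6)) ++ o)
  rw [Token.row, CellKind.rowEntries, encodePuzzle_append, List.append_assoc]
  have h₀ := reach_emitCell .eq (X := 0) (Nat.zero_le N) hY (ts.flatMap Token.code) [] w [] [] o
  refine Reach.mono (.seq (reach_readName _ _ _ _ _ _ _ _) (.seq h₀ (.seq h
    (reach_nextRow _ _ _ _ _ _)))) ?_
  simp only [List.length_replicate, List.length_nil]
  have h₁ := Token.length_le_length_flatMap_code ts
  have h₂ : 1000 * (ts.flatMap Token.code).length ≤ T * (ts.flatMap Token.code).length :=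
    Nat.mul_le_mul_right _ (by omega)
  have h₃ : 1000 * w.length ≤ T * w.length := Nat.mul_le_mul_right _ (by omega)
  rw [Nat.mul_add T, Nat.mul_add T, Nat.mul_left_comm T]
  omega

/-- Each row costs at most `T` steps for twice the length of the whole code; the last summand pays
for clearing the row number in the end. -/
theorem reach_emitRows {Y N T : ℕ} (ts : List Token) (hT : 1000 * (N + 1) ≤ T)
    (hY : Y + ts.length ≤ N) (o : List Bool) :
    emitRows.Reach ⟨ts.flatMap Token.code, [], [], [], [], [], ones Y, [], o⟩
      ⟨[], [], [], [], [], [], [], [], encodePuzzle (Token.rowsEntries ts Y) ++ o⟩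
      (T * (2 * (ts.flatMap Token.code).length) * ts.length + (2 * N + 3)) := by
  induction ts generalizing Y o with
  | nil =>
    refine Reach.mono (.loop_nil rfl (reach_clear _ _)) ?_
    simp only [Store.get, List.length_replicate]
    omega
  | cons t ts ih =>
    rw [List.length_cons] at hY
    have ih' := ih (Y := Y + 1) (by omega)
      (encodePuzzle (CellKind.rowEntries (Token.row (t :: ts)) 0 Y) ++ o)
    have h₁ : T * (2 * (ts.flatMap Token.code).length) * ts.length ≤
        T * (2 * (t.code.length + (ts.flatMap Token.code).length)) * ts.length := by
      gcongr
      omega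
    rw [Token.rowsEntries, encodePuzzle_append, List.append_assoc, List.flatMap_cons,
      List.length_append, List.length_cons, Nat.mul_succ (T * _)]
    have hr (k k₁ k₂ : CellKind) (n : ℕ) (hn : n ≤ 2) :=
      reach_marksRow k k₁ k₂ (Y := Y) ts hn hT (by omega) (by omega) o
    have h₂ : T * (2 * (t.code.length + (ts.flatMap Token.code).length)) =
        2 * (T * t.code.length) + T * (2 * (ts.flatMap Token.code).length) := by ring
    cases t with
    | var w =>
      refine Reach.mono (.loop_false rfl (.pop_false rfl
        (reach_namesRow w ts hT (by omega) (by omega) o)) ih') ?_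
      have h₃ : T * (Token.code (.var w)).length = 2 * (T * w.length) + 3 * T := by
        rw [Token.code, List.length_cons, List.length_cons, length_encodeName]
        ring
      rw [Nat.mul_add T, Nat.mul_add T]
      omega
    | neg =>
      refine Reach.mono (.loop_false rfl (.pop_true rfl (.seq .push
        (hr .eq .neq .cross 1 (by omega)))) ih') ?_
      simp only [Token.code, List.length_cons, List.length_nil] at h₁ h₂ ⊢
      rw [Nat.mul_add T]
      omega
    | conj =>
      refine Reach.mono (.loop_true rfl (.pop_false rfl (.seq (reach_pushList _ _ _)
        (hr .neq .neq .or 2 (by omega)))) ih') ?_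
      simp only [Token.code, List.length_cons, List.length_nil, List.length_replicate] at h₁ h₂ ⊢
      rw [Nat.mul_add T]
      omega
    | disj =>
      refine Reach.mono (.loop_true rfl (.pop_true rfl (.seq (reach_pushList _ _ _)
        (hr .eq .eq .or 2 (by omega)))) ih') ?_
      simp only [Token.code, List.length_cons, List.length_nil, List.length_replicate] at h₁ h₂ ⊢
      rw [Nat.mul_add T]
      omega

end Prog

/-! ### The program for the reduction -/

namespace Prog

open BoolFormula (encodeName)

/-- Moves the code of a name from the stack `a` to the stack `b`, and pushes bits on the stack `e` if
there is none. -/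
def checkName : Prog :=
  loop .a false (push .e true) (push .b false)
    (seq (push .b true) (pop .a (push .e true) (push .b false) (push .b true)))

/-- Counts a formula that was read on the stack `d`. -/
def countFormula : Prog := pop .d (push .e true) skip skip

/-- Checks whether the stack `a` holds the codes of as many formulas as the stack `d` tells,
and moves the codes of the twisted formulas to the stack `b`. If something is wrong, there are bits
left on one of the stacks `d` and `e`. -/
def check : Prog :=
  loop .a true skip
    (seq (push .b false) (seq countFormula
      (pop .a (push .e true) (seq (push .b false) checkName) (seq (push .b true) (push .d true)))))
    (seq (push .b true) (seq countFormula
      (pop .a (push .e true)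
        -- Together with the `true` pushed before, this is `1001` in reversed order: the symbol `10`
        -- of the conjunction and then `01`, the negation that `twist` inserts.
        (seq (pushList .b [true, false, false]) (pushList .d (ones 2)))
        (seq (push .b true) (pushList .d (ones 2))))))

/-- Clears the stacks and writes a string that does not encode a puzzle. -/
def reject : Prog := seq (clear .b) (seq (clear .d) (seq (clear .e) (push .o true)))

/-- Writes the diagram for the formula whose reversed code is on the stack `b`. -/
def emitDiagram : Prog :=
  seq (move .b .a) (seq (push .x true) (seq (emitCell .one) (seq (clear .x)
    (seq (push .y true) emitRows))))

/-- Computes `tantrixReduction`. -/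
def reduction : Prog :=
  seq (push .d true) (seq check (pop .d (pop .e emitDiagram skip reject) skip reject))

/-- A failure means that the input ran out. If this happens in the middle of a pair of bits, it is
noticed once by `pop` and once more by the loop, whence `i + 2`. -/
theorem reach_checkName (d f x y t o : List Bool) : ∀ (a b : List Bool) (i : ℕ),
    (∃ w a', a = encodeName w ++ a' ∧
      checkName.Reach ⟨a, b, d, ones i, f, x, y, t, o⟩
        ⟨a', (encodeName w).reverse ++ b, d, ones i, f, x, y, t, o⟩
        (4 * (encodeName w).length)) ∨
    (∀ w a', a ≠ encodeName w ++ a') ∧ ∃ b' j, b'.length ≤ b.length + a.length ∧ j ≠ 0 ∧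
      j ≤ i + 2 ∧ checkName.Reach ⟨a, b, d, ones i, f, x, y, t, o⟩
        ⟨[], b', d, ones j, f, x, y, t, o⟩ (4 * a.length + 2)
  | [], b, i => by
    refine .inr ⟨fun w a' h => ?_, b, i + 1, by simp, by omega, by omega, .loop_nil rfl .push⟩
    cases w <;> simp [encodeName] at h
  | false :: a, b, i => .inl ⟨[], a, rfl, Reach.mono (.loop_exit rfl .push) (by simp [encodeName])⟩
  | [true], b, i => by
    refine .inr ⟨fun w a' h => ?_, true :: b, i + 1 + 1, by simp, by omega, by omega,
      Reach.mono (.loop_true rfl (.seq .push (.pop_nil rfl .push)) (.loop_nil rfl .push)) ?_⟩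
    · cases w <;> simp [encodeName] at h
    · simp
  | true :: c :: a, b, i => by
    have hp (e : List Bool) :
        (pop .a (push .e true) (push .b false) (push .b true)).Reach
          ⟨c :: a, true :: b, d, e, f, x, y, t, o⟩
          ⟨a, c :: true :: b, d, e, f, x, y, t, o⟩ 2 := by
      cases c with
      | false => exact .pop_false rfl .push
      | true => exact .pop_true rfl .push
    rcases reach_checkName d f x y t o a (c :: true :: b) i with
      ⟨w, a', rfl, h⟩ | ⟨ha, b', j, hb, hj, hj', h⟩
    · refine .inl ⟨c :: w, a', rfl, ?_⟩
      have hb : (encodeName (c :: w)).reverse ++ b = (encodeName w).reverse ++ c :: true :: b := by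
        simp [encodeName]
      rw [hb]
      refine Reach.mono (.loop_true rfl (.seq .push (hp _)) h) ?_
      simp only [encodeName, List.length_cons]
      omega
    · refine .inr ⟨fun w a' h => ?_, b', j, ?_, hj, hj',
        Reach.mono (.loop_true rfl (.seq .push (hp _)) h) ?_⟩
      · cases w with
        | nil => simp [encodeName] at h
        | cons v w =>
          simp only [encodeName, List.cons_append, List.cons.injEq, true_and] at h
          exact ha _ _ h.2
      · simp only [List.length_cons] at hb ⊢
        omega
      · simp only [List.length_cons]
        omega

theorem reach_countFormula (D i : ℕ) (a b f x y t o : List Bool) :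
    countFormula.Reach ⟨a, b, ones D, ones i, f, x, y, t, o⟩
      ⟨a, b, ones (D - 1), ones (i + if D = 0 then 1 else 0), f, x, y, t, o⟩ 2 := by
  cases D with
  | zero => exact .pop_nil rfl .push
  | succ D => exact .pop_true rfl .skip

/-- The code of a list of twisted formulas. -/
def twistedCode (F : List BoolFormula) : List Bool := F.flatMap fun φ => φ.twist.encode

/-- The stack `d` counts the formulas still expected: each token meets one expectation and adds its
arity. A token that nobody expects and a truncated code leave a bit on `e`, which is never removed;
missing formulas stay on `d`. So both stacks end empty exactly if `e` was empty and the input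
consists of `D` formulas. The induction is on the length, since a variable name takes many bits. -/
theorem reach_check (f x y t o a b : List Bool) (D i : ℕ) :
    ∃ b' D' j, b'.length ≤ b.length + 2 * a.length ∧ D' ≤ D + 2 * a.length ∧
      j ≤ i + 2 * a.length ∧
      check.Reach ⟨a, b, ones D, ones i, f, x, y, t, o⟩
        ⟨[], b', ones D', ones j, f, x, y, t, o⟩ (20 * a.length + 2) ∧
      (D' = 0 → j = 0 → i = 0 ∧ ∃ F : List BoolFormula, F.length = D ∧
        F.flatMap BoolFormula.encode = a ∧ b' = (twistedCode F).reverse ++ b) ∧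
      ∀ F : List BoolFormula, F.length = D → i = 0 → F.flatMap BoolFormula.encode = a →
        D' = 0 ∧ j = 0 := by
  induction hn : a.length using Nat.strong_induction_on generalizing a b D i with
  | _ n ih =>
  subst hn
  have hone {D : ℕ} : (i + if D = 0 then 1 else 0) ≤ i + 1 := by split_ifs <;> omega
  have hzero {D : ℕ} (h : (i + if D = 0 then 1 else 0) = 0) : i = 0 ∧ D ≠ 0 := by
    split_ifs at h; omega
  rcases a with _ | ⟨v, _ | ⟨v', a⟩⟩
  · refine ⟨b, D, i, by simp, by simp, by simp, Reach.mono (.loop_nil rfl .skip) (by simp), ?_, ?_⟩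
    · rintro rfl rfl
      exact ⟨rfl, [], rfl, rfl, rfl⟩
    · rintro (_ | ⟨φ, F⟩) hF rfl h
      · exact ⟨hF.symm, rfl⟩
      · cases φ <;> simp [BoolFormula.encode] at h
  · refine ⟨v :: b, D - 1, (i + if D = 0 then 1 else 0) + 1, by simp, by omega, ?_, ?_,
      by omega, ?_⟩
    · have := hone (D := D)
      simp only [List.length_cons, List.length_nil]
      omega
    · cases v with
      | false =>
        exact Reach.mono (.loop_false rfl (.seq .push (.seq (reach_countFormula _ _ _ _ _ _ _ _ _)
          (.pop_nil rfl .push))) (.loop_nil rfl .skip)) (by simp)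
      | true =>
        exact Reach.mono (.loop_true rfl (.seq .push (.seq (reach_countFormula _ _ _ _ _ _ _ _ _)
          (.pop_nil rfl .push))) (.loop_nil rfl .skip)) (by simp)
    · rintro (_ | ⟨φ, F⟩) hF _ h
      · simp at h
      · cases φ <;> simp [BoolFormula.encode] at h
  · cases v with
    | false =>
      cases v' with
      | false =>
        rcases reach_checkName (ones (D - 1)) f x y t o a (false :: false :: b)
          (i + if D = 0 then 1 else 0) with ⟨w, a', rfl, h⟩ | ⟨ha, b', j, hb, hj, hj', h⟩
        · obtain ⟨b', D', j, hb', hD', hj', hr, h₁, h₂⟩ := ih _ (by simp; omega) a'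
            ((encodeName w).reverse ++ false :: false :: b) (D - 1)
            (i + if D = 0 then 1 else 0) rfl
          have := hone (D := D)
          refine ⟨b', D', j, ?_, ?_, ?_, Reach.mono (.loop_false rfl (.seq .push
            (.seq (reach_countFormula _ _ _ _ _ _ _ _ _) (.pop_false rfl (.seq .push h)))) hr) ?_,
            fun hD hj => ?_, ?_⟩
          · simp at hb' ⊢; omega
          · simp; omega
          · simp; omega
          · simp; omega
          · obtain ⟨hi, F, hF, rfl, rfl⟩ := h₁ hD hj
            refine ⟨(hzero hi).1, .var w :: F, ?_, rfl, ?_⟩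
            · rw [List.length_cons, hF]
              exact Nat.sub_add_cancel (Nat.pos_of_ne_zero (hzero hi).2)
            · simp [twistedCode, BoolFormula.twist, BoolFormula.encode]
          · rintro (_ | ⟨φ, F⟩) rfl rfl h
            · simp at h
            · cases φ <;> simp [BoolFormula.encode] at h
              obtain ⟨rfl, rfl⟩ := BoolFormula.encodeName_append_inj h
              exact h₂ F (by simp) (by simp) rfl
        · have := hone (D := D)
          refine ⟨b', D - 1, j, ?_, by omega, ?_, Reach.mono (.loop_false rfl (.seq .push
            (.seq (reach_countFormula _ _ _ _ _ _ _ _ _) (.pop_false rfl (.seq .push h))))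
            (.loop_nil rfl .skip)) ?_, fun _ h => absurd h hj, ?_⟩
          · simp at hb ⊢; omega
          · simp; omega
          · simp; omega
          · rintro (_ | ⟨φ, F⟩) _ _ h
            · simp at h
            · cases φ <;> simp [BoolFormula.encode] at h
              exact absurd h.symm (ha _ _)
      | true =>
        obtain ⟨b', D', j, hb', hD', hj', hr, h₁, h₂⟩ := ih _ (by simp) a
          (true :: false :: b) (D - 1 + 1) (i + if D = 0 then 1 else 0) rfl
        have := hone (D := D)
        refine ⟨b', D', j, ?_, ?_, ?_, Reach.mono (.loop_false rfl (.seq .push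
          (.seq (reach_countFormula _ _ _ _ _ _ _ _ _) (.pop_true rfl (.seq .push .push)))) hr) ?_,
          fun hD hj => ?_, ?_⟩
        · simp at hb' ⊢; omega
        · simp; omega
        · simp; omega
        · simp; omega
        · obtain ⟨hi, _ | ⟨φ, F⟩, hF, rfl, rfl⟩ := h₁ hD hj
          · simp at hF
          · refine ⟨(hzero hi).1, .neg φ :: F, ?_, rfl, ?_⟩
            · exact hF.trans (Nat.sub_add_cancel (Nat.pos_of_ne_zero (hzero hi).2))
            · simp [twistedCode, BoolFormula.twist, BoolFormula.encode]
        · rintro (_ | ⟨φ, F⟩) rfl rfl h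
          · simp at h
          · cases φ <;> simp [BoolFormula.encode] at h
            rename_i φ
            exact h₂ (φ :: F) (by simp) (by simp) (by simpa using h)
    | true =>
      cases v' with
      | false =>
        obtain ⟨b', D', j, hb', hD', hj', hr, h₁, h₂⟩ := ih _ (by simp) a
          (true :: false :: false :: true :: b) (D - 1 + 2) (i + if D = 0 then 1 else 0) rfl
        have := hone (D := D)
        refine ⟨b', D', j, ?_, ?_, ?_, Reach.mono (.loop_true rfl (.seq .push
          (.seq (reach_countFormula _ _ _ _ _ _ _ _ _) (.pop_false rfl
            (.seq (reach_pushList _ _ _) (reach_pushList _ _ _))))) hr) ?_,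
          fun hD hj => ?_, ?_⟩
        · simp at hb' ⊢; omega
        · simp; omega
        · simp; omega
        · simp; omega
        · obtain ⟨hi, _ | ⟨φ, _ | ⟨ψ, F⟩⟩, hF, rfl, rfl⟩ := h₁ hD hj
          · simp at hF
          · simp at hF
          · refine ⟨(hzero hi).1, .conj φ ψ :: F, ?_, ?_, ?_⟩
            · exact (Nat.succ.inj hF).trans (Nat.sub_add_cancel (Nat.pos_of_ne_zero (hzero hi).2))
            · simp [BoolFormula.encode]
            · simp [twistedCode, BoolFormula.twist, BoolFormula.encode]
        · rintro (_ | ⟨φ, F⟩) rfl rfl h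
          · simp at h
          · cases φ <;> simp [BoolFormula.encode] at h
            rename_i φ ψ
            exact h₂ (φ :: ψ :: F) (by simp) (by simp) (by simpa using h)
      | true =>
        obtain ⟨b', D', j, hb', hD', hj', hr, h₁, h₂⟩ := ih _ (by simp) a
          (true :: true :: b) (D - 1 + 2) (i + if D = 0 then 1 else 0) rfl
        have := hone (D := D)
        refine ⟨b', D', j, ?_, ?_, ?_, Reach.mono (.loop_true rfl (.seq .push
          (.seq (reach_countFormula _ _ _ _ _ _ _ _ _) (.pop_true rfl
            (.seq .push (reach_pushList _ _ _))))) hr) ?_,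
          fun hD hj => ?_, ?_⟩
        · simp at hb' ⊢; omega
        · simp; omega
        · simp; omega
        · simp; omega
        · obtain ⟨hi, _ | ⟨φ, _ | ⟨ψ, F⟩⟩, hF, rfl, rfl⟩ := h₁ hD hj
          · simp at hF
          · simp at hF
          · refine ⟨(hzero hi).1, .disj φ ψ :: F, ?_, ?_, ?_⟩
            · exact (Nat.succ.inj hF).trans (Nat.sub_add_cancel (Nat.pos_of_ne_zero (hzero hi).2))
            · simp [BoolFormula.encode]
            · simp [twistedCode, BoolFormula.twist, BoolFormula.encode]
        · rintro (_ | ⟨φ, F⟩) rfl rfl h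
          · simp at h
          · cases φ <;> simp [BoolFormula.encode] at h
            rename_i φ ψ
            exact h₂ (φ :: ψ :: F) (by simp) (by simp) (by simpa using h)

theorem tantrixReduction_of_not {a : List Bool} (h : ¬∃ φ : BoolFormula, φ.encode = a) :
    tantrixReduction a = [true] := dif_neg h

theorem reach_reject (b d e : List Bool) :
    reject.Reach ⟨[], b, d, e, [], [], [], [], []⟩ ⟨[], [], [], [], [], [], [], [], [true]⟩
      (2 * b.length + 2 * d.length + 2 * e.length + 7) := by
  refine Reach.mono (.seq (reach_clear _ _) (.seq (reach_clear _ _)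
    (.seq (reach_clear _ _) .push))) ?_
  simp only [Store.set, Store.get]
  omega

theorem reach_emitDiagram {N T : ℕ} (ts : List Token) (hT : 1000 * (N + 1) ≤ T)
    (hN : ts.length + 1 ≤ N) :
    emitDiagram.Reach ⟨[], (ts.flatMap Token.code).reverse, [], [], [], [], [], [], []⟩
      ⟨[], [], [], [], [], [], [], [], encodePuzzle (Token.layout ts)⟩
      (2 * T * ((ts.flatMap Token.code).length + 1) * (ts.length + 1)) := by
  have h₁ := reach_move (k := .b) (k' := .a) (by decide)
    ⟨[], (ts.flatMap Token.code).reverse, [], [], [], [], [], [], []⟩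
  simp only [Store.set, Store.get, List.append_nil, List.reverse_reverse,
    List.length_reverse] at h₁
  have h₂ := reach_emitCell .one (X := 1) (Y := 0) (N := N) (by omega) (by omega)
    (ts.flatMap Token.code) [] [] [] [] []
  have h₃ := reach_emitRows (Y := 1) ts hT (by omega)
    (encodePuzzle (CellKind.one.entries (1, 0) (List.finRange 6)) ++ [])
  rw [List.append_nil, ← encodePuzzle_append] at h₃
  rw [List.append_nil] at h₂
  refine Reach.mono (.seq h₁ (.seq .push (.seq h₂ (.seq (reach_clear _ _) (.seq .push h₃))))) ?_
  have h₄ : 2 * T * ((ts.flatMap Token.code).length + 1) * (ts.length + 1) =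
      T * (2 * (ts.flatMap Token.code).length) * ts.length +
        2 * (T * (ts.flatMap Token.code).length) + 2 * (T * ts.length) + 2 * T := by ring
  have h₅ : 1000 * (ts.flatMap Token.code).length ≤ T * (ts.flatMap Token.code).length :=
    Nat.mul_le_mul_right _ (by omega)
  rw [h₄]
  simp only [Store.get, List.length_replicate]
  omega

/-- Only conjunctions grow, each by the two bits of a negation, as many as its own symbol has. -/
theorem length_encode_twist (φ : BoolFormula) :
    φ.twist.encode.length ≤ 2 * φ.encode.length := by
  induction φ <;> simp [BoolFormula.twist, BoolFormula.encode] <;> omega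

theorem reach_reduction (a : List Bool) :
    reduction.Reach ⟨a, [], [], [], [], [], [], [], []⟩
      ⟨[], [], [], [], [], [], [], [], tantrixReduction a⟩
      (40 * a.length + 20 + 2000 * (a.length + 3) * (2 * a.length + 1) * (a.length + 1)) := by
  obtain ⟨b, D, j, hb, hD, hj, hr, h₁, h₂⟩ := reach_check [] [] [] [] [] a [] 1 0
  simp only [List.length_nil, Nat.zero_add] at hb hj
  by_cases h : ∃ φ : BoolFormula, φ.encode = a
  · obtain ⟨φ, rfl⟩ := h
    obtain ⟨rfl, rfl⟩ := h₂ [φ] rfl rfl (by simp)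
    obtain ⟨-, F, hF, hF', rfl⟩ := h₁ rfl rfl
    obtain ⟨ψ, rfl⟩ := List.length_eq_one_iff.1 hF
    obtain rfl : ψ = φ := BoolFormula.encode_injective (by simpa using hF')
    have hb' : (twistedCode [ψ]).reverse ++ [] =
        (ψ.twist.tokens.flatMap Token.code).reverse := by
      simp [twistedCode, BoolFormula.flatMap_code_tokens]
    rw [hb'] at hr
    rw [tantrixReduction_encode]
    have hl := length_encode_twist ψ
    have hl' := Token.length_le_length_flatMap_code ψ.twist.tokens
    -- The twisted code is at most twice as long as the input and spends at least two bits on each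
    -- token, so there are at most `ψ.encode.length` tokens.
    have he := reach_emitDiagram (N := ψ.encode.length + 2) (T := 1000 * (ψ.encode.length + 3))
      ψ.twist.tokens le_rfl (by rw [BoolFormula.flatMap_code_tokens] at hl'; omega)
    rw [BoolFormula.flatMap_code_tokens] at hl' hr he
    refine Reach.mono (.seq .push (.seq hr (.pop_nil rfl (.pop_nil rfl he)))) ?_
    have : 2 * (1000 * (ψ.encode.length + 3)) * (ψ.twist.encode.length + 1) *
        (ψ.twist.tokens.length + 1) ≤
        2000 * (ψ.encode.length + 3) * (2 * ψ.encode.length + 1) * (ψ.encode.length + 1) := by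
      rw [← Nat.mul_assoc 2 1000]
      gcongr
      omega
    linarith
  · rw [tantrixReduction_of_not h]
    refine Reach.mono (?_ : reduction.Reach _ _ (40 * a.length + 20)) (Nat.le_add_right _ _)
    rcases D with _ | D
    · rcases j with _ | j
      · obtain ⟨-, F, hF, hF', -⟩ := h₁ rfl rfl
        obtain ⟨ψ, rfl⟩ := List.length_eq_one_iff.1 hF
        exact absurd ⟨ψ, by simpa using hF'⟩ h
      · refine Reach.mono (.seq .push (.seq hr (.pop_nil rfl (.pop_true rfl
          (reach_reject _ _ _))))) ?_
        simp only [List.length_replicate]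
        omega
    · refine Reach.mono (.seq .push (.seq hr (.pop_true rfl (reach_reject _ _ _)))) ?_
      simp only [List.length_replicate]
      omega

/-- The reduction is computable in polynomial time. -/
theorem polyTimeComputable_tantrixReduction : PolyTimeComputable tantrixReduction := by
  refine polyTimeComputable reduction
    (40 * .X + 20 + 2000 * (.X + 3) * (2 * .X + 1) * (.X + 1)) fun x => ?_
  have := reach_reduction x
  simpa using this

end Prog

theorem theorem1 : ParsimoniouslyReduces sharpSAT sharpTRP :=
  ⟨tantrixReduction, Prog.polyTimeComputable_tantrixReduction, sharpSAT_eq_sharpTRP⟩
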